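/- Let $P_\infty$ be the infinite path graph (vertex set $\mathbb{Z}$, consecutive integers joined by an edge), so that for $k\ge 1$ its $k$-path Laplacian $(L_k v)_n=\sum_{m:\,d(n,m)=k}(v_n-v_m)=2v_n-v_{n+k}-v_{n-k}$ is a bounded operator on $\ell^2(\mathbb{Z})$. Let $s>1$ and let $L=\sum_{k=1}^{\infty}k^{-s}L_k$ be the Mellin-transformed $k$-path Laplacian (the series converges in operator norm). Let $u:[0,\infty)\to\ell^2(\mathbb{Z})$ be the solution of $\frac{d}{dt}u(t)=-Lu(t)$, $u(0)=e_0$, where $(e_0)_n=\delta_{n,0}$. For $0<\alpha\le 2$ and $\gamma>0$ denote by $$f(\xi;\alpha,0,\gamma,0)=\frac1{2\pi}\int_{-\infty}^{\infty}e^{-|\gamma z|^{\alpha}}e^{i\xi z}\,dz,\qquad \xi\in\mathbb{R},$$ the density of the symmetric stable distribution $S(\alpha,0,\gamma,0)$. If $s\neq 3$, then $$(u(t))_x=t^{-1/\alpha}f\bigl(t^{-1/\alpha}x;\alpha,0,\gamma,0\bigr)+o\bigl(t^{-1/\alpha}\bigr)\qquad\text{as } t\to\infty,$$ uniformly in $x\in\mathbb{Z}$,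 where $$\alpha=s-1,\quad \gamma=\Bigl(-\frac{\pi}{\Gamma(s)\cos(\pi s/2)}\Bigr)^{1/(s-1)}\quad\text{if } 1<s<3,$$ $$\alpha=2,\quad \gamma=\sqrt{\zeta(s-2)}\quad\text{if } s>3.$$ Moreover, if $1<s<3$ and $\alpha,\gamma$ are as above, then $$f(\xi;\alpha,0,\gamma,0)\sim\frac{1}{|\xi|^{s}}\qquad\text{as }\xi\to\pm\infty,$$ i.e. the quotient of the two sides tends to $1$ as $\xi\to+\infty$ and as $\xi\to-\infty$. -/

import Mathlib

open Filter Topology MeasureTheory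
open scoped ENNReal

noncomputable section

namespace PathLaplacian

/-- The `k`-path Laplacian mapping on functions on the vertices of a (locally finite, connected)
graph: `(𝓛_k f)(v) = ∑_{w : d(v,w) = k} (f(v) - f(w))`. -/
def kPathMap {V : Type*} (G : SimpleGraph V) (k : ℕ) (f : V → ℂ) (v : V) : ℂ :=
  ∑ᶠ (w : V) (_ : G.dist v w = k), (f v - f w)

/-- The infinite path graph: vertex set `ℤ`, consecutive integers are joined by an edge. -/
def infinitePath : SimpleGraph ℤ where
  Adj m n := n = m + 1 ∨ m = n + 1
  symm := ⟨fun _ _ h => h.symm⟩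
  loopless := ⟨fun _ h => by omega⟩

/-- The Hilbert space `ℓ²` over the vertices of the infinite path graph. -/
abbrev EllTwo : Type := lp (fun _ : ℤ => ℂ) 2

theorem infinitePath_walk_add (m : ℤ) (j : ℕ) :
    ∃ p : infinitePath.Walk m (m + j), p.length = j := by
  induction j with
  | zero => exact ⟨SimpleGraph.Walk.nil.copy rfl (by simp), by simp⟩
  | succ j ih =>
    obtain ⟨p, hp⟩ := ih
    have h : infinitePath.Adj (m + j) (m + (j + 1 : ℕ)) := Or.inl (by push_cast; ring)
    exact ⟨p.append h.toWalk, by simp [hp]⟩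

theorem infinitePath_natAbs_le_length {m n : ℤ} (p : infinitePath.Walk m n) :
    (n - m).natAbs ≤ p.length := by
  induction p with
  | nil => simp
  | cons h p ih =>
    rw [SimpleGraph.Walk.length_cons]
    have h' := h
    change _ = _ + 1 ∨ _ = _ + 1 at h'
    omega

theorem infinitePath_exists_walk (m n : ℤ) :
    ∃ p : infinitePath.Walk m n, p.length = (n - m).natAbs := by
  rcases le_total m n with h | h
  · obtain ⟨p, hp⟩ := infinitePath_walk_add m (n - m).natAbs
    exact ⟨p.copy rfl (by omega), by simp [hp]⟩
  · obtain ⟨p, hp⟩ := infinitePath_walk_add n (n - m).natAbs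
    exact ⟨(p.copy rfl (by omega)).reverse, by simp [hp]⟩

theorem infinitePath_connected : infinitePath.Connected :=
  { preconnected := fun m n => ⟨(infinitePath_exists_walk m n).choose⟩
    nonempty := ⟨0⟩ }

theorem infinitePath_dist (m n : ℤ) : infinitePath.dist m n = (n - m).natAbs := by
  apply le_antisymm
  · obtain ⟨p, hp⟩ := infinitePath_exists_walk m n
    exact hp ▸ SimpleGraph.dist_le p
  · obtain ⟨p, hp⟩ := infinitePath_connected.exists_walk_length_eq_dist m n
    exact hp ▸ infinitePath_natAbs_le_length p

/-- On the infinite path graph, `(𝓛_k u)_n = 2 u_n - u_{n+k} - u_{n-k}`. -/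
theorem kPathMap_infinitePath (k : ℕ) (f : ℤ → ℂ) (n : ℤ) :
    kPathMap infinitePath k f n = 2 * f n - f (n + k) - f (n - k) := by
  have hset : ∀ w : ℤ, infinitePath.dist n w = k ↔ w ∈ ({n + k, n - k} : Finset ℤ) := by
    intro w
    rw [infinitePath_dist]
    simp only [Finset.mem_insert, Finset.mem_singleton]
    omega
  unfold kPathMap
  simp only [hset]
  rw [finsum_mem_finset_eq_sum]
  rcases Nat.eq_zero_or_pos k with rfl | hk
  · simp; ring
  · rw [Finset.sum_pair (by omega)]
    ring

theorem memℓp_shift (u : EllTwo) (a : ℤ) : Memℓp (fun n : ℤ => u (n + a)) 2 := by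
  have h := (lp.memℓp u).summable (by norm_num)
  refine memℓp_gen ?_
  exact h.comp_injective (add_left_injective a)

theorem norm_shift (u : EllTwo) (a : ℤ) :
    ‖(⟨fun n : ℤ => u (n + a), memℓp_shift u a⟩ : EllTwo)‖ = ‖u‖ := by
  rw [lp.norm_eq_tsum_rpow (by norm_num), lp.norm_eq_tsum_rpow (by norm_num)]
  congr 1
  exact (Equiv.addRight a).tsum_eq (fun n => ‖u n‖ ^ (2 : ℝ≥0∞).toReal)

theorem kPathMap_eq_shift (k : ℕ) (u : EllTwo) :
    kPathMap infinitePath k u =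
      ((((2 : ℂ) • u - ⟨fun n : ℤ => u (n + k), memℓp_shift u k⟩
        - ⟨fun n : ℤ => u (n + (-k : ℤ)), memℓp_shift u (-k)⟩ : EllTwo)) : ℤ → ℂ) := by
  funext n
  rw [kPathMap_infinitePath]
  change _ = 2 * u n - u (n + k) - u (n + (-k : ℤ))
  rw [← sub_eq_add_neg]

theorem memℓp_kPathMap (k : ℕ) (u : EllTwo) : Memℓp (kPathMap infinitePath k u) 2 := by
  rw [kPathMap_eq_shift]
  exact lp.memℓp _

/-- The `k`-path Laplacian `L_k` as a bounded operator on `ℓ²` over the infinite path graph. -/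
def kPathLaplacian (k : ℕ) : EllTwo →L[ℂ] EllTwo :=
  LinearMap.mkContinuous
    { toFun := fun u => ⟨kPathMap infinitePath k u, memℓp_kPathMap k u⟩
      map_add' := fun u v => by
        ext n
        simp only [lp.coeFn_add, Pi.add_apply, kPathMap_infinitePath]
        ring
      map_smul' := fun c u => by
        ext n
        simp only [lp.coeFn_smul, Pi.smul_apply, kPathMap_infinitePath, smul_eq_mul,
          RingHom.id_apply]
        ring }
    4
    (fun u => by
      have h : (⟨kPathMap infinitePath k u, memℓp_kPathMap k u⟩ : EllTwo) =
          (2 : ℂ) • u - ⟨fun n : ℤ => u (n + k), memℓp_shift u k⟩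
            - ⟨fun n : ℤ => u (n + (-k : ℤ)), memℓp_shift u (-k)⟩ :=
        Subtype.ext (kPathMap_eq_shift k u)
      change ‖(⟨kPathMap infinitePath k u, memℓp_kPathMap k u⟩ : EllTwo)‖ ≤ _
      rw [h]
      refine (norm_sub_le _ _).trans ((add_le_add_left (norm_sub_le _ _) _).trans ?_)
      rw [norm_shift, norm_shift, norm_smul]
      norm_num
      linarith)

theorem kPathLaplacian_apply (k : ℕ) (u : EllTwo) (n : ℤ) :
    kPathLaplacian k u n = kPathMap infinitePath k u n := rfl

theorem norm_kPathLaplacian_le (k : ℕ) : ‖kPathLaplacian k‖ ≤ 4 :=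
  LinearMap.mkContinuous_norm_le _ (by norm_num) _

/-- The Mellin-transformed `k`-path Laplacian `∑_{k ≥ 1} k^{-s} L_k`; the series converges in
operator norm for `s > 1` (see `summable_mellinLaplacian`). -/
def mellinLaplacian (s : ℝ) : EllTwo →L[ℂ] EllTwo :=
  ∑' k : ℕ, ((1 / ((k : ℝ) + 1) ^ s : ℝ) : ℂ) • kPathLaplacian (k + 1)

theorem summable_mellinLaplacian {s : ℝ} (hs : 1 < s) :
    Summable fun k : ℕ => ((1 / ((k : ℝ) + 1) ^ s : ℝ) : ℂ) • kPathLaplacian (k + 1) := by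
  have h : Summable fun k : ℕ => (1 / ((k : ℝ) + 1) ^ s) * 4 := by
    have h1 := (summable_nat_add_iff 1).2 (Real.summable_one_div_nat_rpow.2 hs)
    simpa using h1.mul_right 4
  refine Summable.of_norm_bounded h (fun k => ?_)
  rw [norm_smul, Complex.norm_real, Real.norm_of_nonneg (by positivity)]
  exact mul_le_mul_of_nonneg_left (norm_kPathLaplacian_le _) (by positivity)

/-- The unit vector `e_0`, the profile concentrated at the origin. -/
def e0 : EllTwo := lp.single 2 (0 : ℤ) (1 : ℂ)

/-- `u` solves `u'(t) = -L u(t)` for `t ≥ 0` with `u(0) = w`, the derivative being taken in `ℓ²`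
(one-sided at `t = 0`). -/
def IsSolution (L : EllTwo →L[ℂ] EllTwo) (w : EllTwo) (u : ℝ → EllTwo) : Prop :=
  u 0 = w ∧ ∀ t : ℝ, 0 ≤ t → HasDerivWithinAt u (-(L (u t))) (Set.Ici 0) t

/-- The evolution equation has a solution, namely `e^{-tL} w`. -/
theorem isSolution_exp (L : EllTwo →L[ℂ] EllTwo) (w : EllTwo) :
    IsSolution L w (fun t => NormedSpace.exp (t • (-L)) w) := by
  refine ⟨by simp, fun t _ => ?_⟩
  have h := (hasDerivAt_exp_smul_const' (𝕂 := ℝ) (-L) t).hasDerivWithinAt (s := Set.Ici 0)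
  have h2 := ((ContinuousLinearMap.apply ℂ EllTwo w).restrictScalars ℝ).hasFDerivAt
    |>.comp_hasDerivWithinAt t h
  exact h2

/-- The auxiliary function `ω(z, α)` in the characteristic function of a stable law. -/
def stableOmega (z α : ℝ) : ℝ :=
  if α = 1 then 2 / Real.pi * Real.log |z| else -Real.tan (Real.pi * α / 2)

/-- The characteristic function
`φ(z; α, β, γ, δ) = exp(-|γ z|^α (1 + i β sign(z) ω(z, α)) + i δ z)`. -/
def stableCharFun (z α β γ δ : ℝ) : ℂ :=
  Complex.exp (-((|γ * z| ^ α : ℝ) : ℂ) *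
      (1 + Complex.I * (β : ℂ) * ((SignType.sign z : ℝ) : ℂ) * (stableOmega z α : ℂ))
    + Complex.I * (δ : ℂ) * (z : ℂ))

/-- The density `f(ξ; α, β, γ, δ) = (1 / 2π) ∫ φ(z; α, β, γ, δ) e^{iξz} dz` of the stable
distribution. The integral is real (see `stableDensity_eq_integral`); taking the real part only
makes the type real. -/
def stableDensity (ξ α β γ δ : ℝ) : ℝ :=
  ((1 / (2 * Real.pi) : ℂ) *
    ∫ z : ℝ, stableCharFun z α β γ δ * Complex.exp (Complex.I * (ξ : ℂ) * (z : ℂ))).re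

theorem conj_stableCharFun (z α β γ δ : ℝ) :
    (starRingEnd ℂ) (stableCharFun z α β γ δ) = stableCharFun (-z) α β γ δ := by
  unfold stableCharFun stableOmega
  rw [← Complex.exp_conj]
  congr 1
  simp [Left.sign_neg]

theorem stableDensity_eq_integral (ξ α β γ δ : ℝ) :
    (stableDensity ξ α β γ δ : ℂ) = (1 / (2 * Real.pi) : ℂ) *
      ∫ z : ℝ, stableCharFun z α β γ δ * Complex.exp (Complex.I * (ξ : ℂ) * (z : ℂ)) := by
  unfold stableDensity
  rw [← Complex.conj_eq_iff_re, map_mul, ← integral_conj]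
  congr 1
  · simp [Complex.conj_ofNat]
  · rw [← integral_neg_eq_self]
    congr 1
    funext z
    rw [map_mul, conj_stableCharFun, ← Complex.exp_conj]
    simp

/-- `u(t)_x = t^{-1/α} f(t^{-1/α} x; α, 0, γ, 0) + o(t^{-1/α})` as `t → ∞`, uniformly in `x ∈ ℤ`. -/
def HasStableAsymptotics (u : ℝ → EllTwo) (α γ : ℝ) : Prop :=
  ∀ ε : ℝ, 0 < ε → ∃ T : ℝ, 0 < T ∧ ∀ t : ℝ, T ≤ t → ∀ x : ℤ,
    ‖u t x - ((t ^ (-(1 / α)) * stableDensity (t ^ (-(1 / α)) * (x : ℝ)) α 0 γ 0 : ℝ) : ℂ)‖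
      ≤ ε * t ^ (-(1 / α))

end PathLaplacian

end

noncomputable section

namespace PathLaplacian

/-! ### The Fourier representation of the solution -/

/-! Fourier series diagonalise the generator: it becomes multiplication by the even function ω(θ) =
∑ k^{-s} (2 - 2 cos kθ), so u(t)_x = (1/2π) ∫_{-π}^{π} e^{-tω(θ)} e^{ixθ} dθ (`solution_apply`). Put
l = t^{-1/α} and θ = l z. The error, divided by l, is at most the L¹ distance between e^{-tω(lz)},
cut off to |lz| ≤ π, and e^{-|γz|^α}. This bound does not involve x, hence the uniformity, and it
tends to 0 by dominated convergence once ω(θ) ~ γ^α |θ|^α at the origin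
(`hasStableAsymptotics_of_symbol`).

The exponent and the scale are thus read off from ω near 0. For s > 3 the series may be divided by
θ² termwise, and the limit is ζ(s-2). For s < 3 the quotient ω(θ)/θ^{s-1} is a Riemann sum of mesh θ
for ∫_0^∞ 2(1 - cos y) y^{-s} dy. Two applications of Tonelli and the reflection formula for Γ
evaluate this integral (`integral_one_sub_cos_mul_rpow`).

For the tail, scaling reduces the density to the real part of ∫_0^∞ e^{-b z^α + iz} dz with b = γ^α
ξ^{-α} → 0. On the ray of argument π/4 the factor e^{iz} decays, so the integral can be expanded to
first order in b. The zeroth-order term is the imaginary number i; the first-order term is an Euler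
integral and gives b Γ(α+1) sin(πα/2). The chosen γ makes the resulting constant equal to 1. -/

instance fact_two_pi_pos : Fact (0 < 2 * Real.pi) := ⟨Real.two_pi_pos⟩

/-- The map sending a continuous function on the circle to its sequence of Fourier coefficients. -/
def fourierSeq : C(AddCircle (2 * Real.pi), ℂ) →L[ℂ] EllTwo :=
  ((fourierBasis (T := 2 * Real.pi)).repr.toContinuousLinearEquiv :
    Lp ℂ 2 (AddCircle.haarAddCircle (T := 2 * Real.pi)) →L[ℂ] EllTwo).comp
    (ContinuousMap.toLp 2 AddCircle.haarAddCircle ℂ)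

theorem fourierSeq_apply (g : C(AddCircle (2 * Real.pi), ℂ)) (n : ℤ) :
    fourierSeq g n = fourierCoeff g n := by
  rw [← fourierCoeff_toLp, ← fourierBasis_repr]
  rfl

theorem fourierCoeff_fourier_mul (g : C(AddCircle (2 * Real.pi), ℂ)) (k n : ℤ) :
    fourierCoeff (fourier k * g : C(AddCircle (2 * Real.pi), ℂ)) n = fourierCoeff g (n - k) := by
  unfold fourierCoeff
  congr 1
  funext x
  have h : -(n - k) = -n + k := by ring
  rw [h, fourier_add]
  simp [mul_assoc]

theorem fourierSeq_one : fourierSeq 1 = e0 := by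
  ext n
  have h : (1 : C(AddCircle (2 * Real.pi), ℂ)) = fourier 0 := by
    ext x; simp
  rw [fourierSeq_apply, h, fourierCoeff_fourier, e0, lp.coeFn_single]

/-- The symbol of the `k`-path Laplacian as a continuous function on the circle. -/
def circleSymbolTerm (k : ℕ) : C(AddCircle (2 * Real.pi), ℂ) :=
  (2 : ℂ) • 1 - fourier (-(k : ℤ)) - fourier (k : ℤ)

/-- Multiplying by e^{±ikθ} shifts Fourier coefficients by ±k, so a combination of shifts is a
multiplication operator. -/
theorem kPathLaplacian_fourierSeq (k : ℕ) (g : C(AddCircle (2 * Real.pi), ℂ)) :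
    kPathLaplacian k (fourierSeq g) = fourierSeq (circleSymbolTerm k * g) := by
  have h : circleSymbolTerm k * g =
      (2 : ℂ) • g - fourier (-(k : ℤ)) * g - fourier (k : ℤ) * g := by
    simp [circleSymbolTerm, sub_mul]
  ext n
  rw [h, map_sub, map_sub, map_smul, kPathLaplacian_apply, kPathMap_infinitePath]
  change _ = 2 * fourierSeq g n - fourierSeq _ n - fourierSeq _ n
  simp only [fourierSeq_apply, fourierCoeff_fourier_mul, sub_neg_eq_add]

theorem norm_circleSymbolTerm_le (k : ℕ) : ‖circleSymbolTerm k‖ ≤ 4 := by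
  refine (norm_sub_le _ _).trans ((add_le_add_left (norm_sub_le _ _) _).trans ?_)
  rw [fourier_norm, fourier_norm, norm_smul]
  norm_num

/-- The symbol of the Mellin-transformed Laplacian as a continuous function on the circle. -/
def circleSymbol (s : ℝ) : C(AddCircle (2 * Real.pi), ℂ) :=
  ∑' k : ℕ, ((1 / ((k : ℝ) + 1) ^ s : ℝ) : ℂ) • circleSymbolTerm (k + 1)

theorem summable_one_div_succ_rpow {s : ℝ} (hs : 1 < s) :
    Summable fun k : ℕ => 1 / ((k : ℝ) + 1) ^ s := by
  simpa using (summable_nat_add_iff 1).2 (Real.summable_one_div_nat_rpow.2 hs)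

theorem summable_circleSymbol {s : ℝ} (hs : 1 < s) :
    Summable fun k : ℕ => ((1 / ((k : ℝ) + 1) ^ s : ℝ) : ℂ) • circleSymbolTerm (k + 1) := by
  refine Summable.of_norm_bounded ((summable_one_div_succ_rpow hs).mul_right 4) (fun k => ?_)
  rw [norm_smul, Complex.norm_real, Real.norm_of_nonneg (by positivity)]
  exact mul_le_mul_of_nonneg_left (norm_circleSymbolTerm_le _) (by positivity)

theorem mellinLaplacian_fourierSeq {s : ℝ} (hs : 1 < s) (g : C(AddCircle (2 * Real.pi), ℂ)) :
    mellinLaplacian s (fourierSeq g) = fourierSeq (circleSymbol s * g) := by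
  have h1 := ((summable_mellinLaplacian hs).hasSum.mapL
    (ContinuousLinearMap.apply ℂ EllTwo (fourierSeq g)))
  have h2 := ((summable_circleSymbol hs).hasSum.mul_right g).mapL fourierSeq
  refine h1.unique (h2.congr_fun fun k => ?_)
  simp only [ContinuousLinearMap.apply_apply,
    kPathLaplacian_fourierSeq, smul_mul_assoc, map_smul]

/-- The symbol `ω(θ) = ∑_{k ≥ 1} k^{-s} (2 - 2 cos (k θ))` of the Mellin-transformed Laplacian. -/
def symbol (s θ : ℝ) : ℝ :=
  ∑' k : ℕ, 1 / ((k : ℝ) + 1) ^ s * (2 * (1 - Real.cos (((k : ℝ) + 1) * θ)))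

theorem circleSymbolTerm_coe (k : ℕ) (θ : ℝ) :
    circleSymbolTerm k (θ : AddCircle (2 * Real.pi)) = ((2 * (1 - Real.cos (k * θ)) : ℝ) : ℂ) := by
  have h : ∀ n : ℤ, fourier n (θ : AddCircle (2 * Real.pi)) = Complex.exp (n * θ * Complex.I) := by
    intro n
    rw [fourier_coe_apply]
    congr 1
    have : (Real.pi : ℂ) ≠ 0 := by exact_mod_cast Real.pi_ne_zero
    push_cast
    field_simp
  simp only [circleSymbolTerm, ContinuousMap.sub_apply, ContinuousMap.smul_apply,
    ContinuousMap.one_apply, h]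
  push_cast
  rw [Complex.cos]
  simp only [smul_eq_mul, neg_mul]
  ring

theorem circleSymbol_coe {s : ℝ} (hs : 1 < s) (θ : ℝ) :
    circleSymbol s (θ : AddCircle (2 * Real.pi)) = (symbol s θ : ℂ) := by
  have h1 := (summable_circleSymbol hs).hasSum.mapL
    (ContinuousMap.evalCLM ℂ (θ : AddCircle (2 * Real.pi)))
  rw [symbol, Complex.ofReal_tsum]
  refine h1.tsum_eq.symm.trans (tsum_congr fun k => ?_)
  simp only [ContinuousMap.evalCLM_apply, ContinuousMap.smul_apply, circleSymbolTerm_coe,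
    smul_eq_mul]
  push_cast
  rfl

theorem continuous_symbol {s : ℝ} (hs : 1 < s) : Continuous (symbol s) := by
  have h : symbol s = fun θ : ℝ => (circleSymbol s (θ : AddCircle (2 * Real.pi))).re := by
    funext θ
    rw [circleSymbol_coe hs, Complex.ofReal_re]
  rw [h]
  exact Complex.continuous_re.comp ((circleSymbol s).continuous.comp (AddCircle.continuous_mk' _))

/-- A bounded operator is Lipschitz, so the ODE uniqueness theorem applies; any given solution may
then be replaced by the explicit Fourier one. -/
theorem isSolution_unique (L : EllTwo →L[ℂ] EllTwo) (w : EllTwo) {u v : ℝ → EllTwo}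
    (hu : IsSolution L w u) (hv : IsSolution L w v) {t : ℝ} (ht : 0 ≤ t) : u t = v t := by
  have key : ∀ {u : ℝ → EllTwo}, IsSolution L w u → ContinuousOn u (Set.Icc 0 t) ∧
      ∀ x ∈ Set.Ico 0 t, HasDerivWithinAt u ((fun _ y => -(L y)) x (u x)) (Set.Ici x) x := by
    intro u hu
    refine ⟨fun x hx => ((hu.2 x hx.1).continuousWithinAt).mono Set.Icc_subset_Ici_self,
      fun x hx => (hu.2 x hx.1).mono (Set.Ici_subset_Ici.2 hx.1)⟩
  have hL : ∀ x : ℝ, LipschitzWith ‖L‖₊ ((fun _ y => -(L y)) x : EllTwo → EllTwo) := fun x => by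
    exact (-L).lipschitz.weaken (by simp)
  exact ODE_solution_unique hL (key hu).1 (key hu).2 (key hv).1 (key hv).2
    (hu.1.trans hv.1.symm) ⟨ht, le_rfl⟩

/-- The exponential is taken in the Banach algebra of continuous functions on the circle; the
bounded map `fourierSeq` carries its derivative over to ℓ². -/
theorem isSolution_fourierSeq_exp {s : ℝ} (hs : 1 < s) :
    IsSolution (mellinLaplacian s) e0
      (fun t => fourierSeq (NormedSpace.exp (t • (-circleSymbol s)))) := by
  refine ⟨by simp [fourierSeq_one], fun t _ => ?_⟩
  have h := (hasDerivAt_exp_smul_const' (𝕂 := ℝ) (-circleSymbol s) t).hasDerivWithinAt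
    (s := Set.Ici 0)
  have h2 := (fourierSeq.restrictScalars ℝ).hasFDerivAt.comp_hasDerivWithinAt t h
  convert! h2 using 1
  rw [mellinLaplacian_fourierSeq hs, ContinuousLinearMap.coe_restrictScalars', neg_mul, map_neg]

theorem exp_circle_apply (g : C(AddCircle (2 * Real.pi), ℂ)) (x : AddCircle (2 * Real.pi)) :
    (NormedSpace.exp g) x = Complex.exp (g x) := by
  rw [Complex.exp_eq_exp_ℂ]
  exact NormedSpace.map_exp (ContinuousMap.evalAlgHom ℂ ℂ x)
    (continuous_eval_const x) g

/-- Fourier representation of the solution of the evolution equation. -/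
theorem solution_apply {s : ℝ} (hs : 1 < s) {u : ℝ → EllTwo}
    (hu : IsSolution (mellinLaplacian s) e0 u) {t : ℝ} (ht : 0 ≤ t) (x : ℤ) :
    u t x = (1 / (2 * Real.pi) : ℂ) * ∫ θ in -Real.pi..Real.pi,
      Complex.exp (-(t * symbol s θ : ℝ)) * Complex.exp (Complex.I * (x : ℂ) * (θ : ℂ)) := by
  -- Evenness of the symbol: Fourier coefficients carry e^{-ixθ}, and the reflection θ ↦ -θ in
  -- `hneg` turns this into e^{ixθ}.
  have hodd : ∀ θ, symbol s (-θ) = symbol s θ := fun θ => by simp [symbol]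
  rw [isSolution_unique _ _ hu (isSolution_fourierSeq_exp hs) ht, fourierSeq_apply,
    fourierCoeff_eq_intervalIntegral _ _ (-Real.pi), Complex.real_smul]
  have hpi : -Real.pi + 2 * Real.pi = Real.pi := by ring
  rw [hpi]
  congr 1
  · push_cast; rfl
  have hneg := intervalIntegral.integral_comp_neg (a := -Real.pi) (b := Real.pi) (fun θ : ℝ =>
    Complex.exp (-(t * symbol s θ : ℝ)) * Complex.exp (Complex.I * (x : ℂ) * (θ : ℂ)))
  rw [neg_neg] at hneg
  refine Eq.trans (intervalIntegral.integral_congr fun θ _ => ?_) hneg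
  simp only [exp_circle_apply, ContinuousMap.smul_apply, ContinuousMap.neg_apply,
    circleSymbol_coe hs, hodd, fourier_coe_apply, smul_eq_mul]
  rw [mul_comm]
  have : (Real.pi : ℂ) ≠ 0 := by exact_mod_cast Real.pi_ne_zero
  congr 2
  · simp
  · push_cast
    field_simp

/-! ### From the behaviour of the symbol at the origin to the large time asymptotics -/

theorem integrable_exp_neg_mul_abs_rpow {α b : ℝ} (hα : 0 < α) (hb : 0 < b) :
    Integrable fun z : ℝ => Real.exp (-(b * |z| ^ α)) := by
  have h : IntegrableOn (fun x : ℝ => Real.exp (-b * x ^ α)) (Set.Ioi 0) := by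
    simpa using integrableOn_rpow_mul_exp_neg_mul_rpow (s := 0) (by norm_num) hα hb
  have h1 : IntegrableOn (fun z : ℝ => Real.exp (-(b * |z| ^ α))) (Set.Ioi 0) :=
    h.congr_fun (fun x hx => by simp [abs_of_pos (Set.mem_Ioi.1 hx)]) measurableSet_Ioi
  have h2 : IntegrableOn (fun z : ℝ => Real.exp (-(b * |z| ^ α))) (Set.Iic 0) := by
    rw [← Measure.map_neg_eq_self (volume : Measure ℝ)]
    have m : MeasurableEmbedding fun x : ℝ => -x := (Homeomorph.neg ℝ).measurableEmbedding
    rw [m.integrableOn_map_iff]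
    simp_rw [Function.comp_def, abs_neg, Set.neg_preimage, Set.neg_Iic, neg_zero]
    exact Iff.mpr integrableOn_Ici_iff_integrableOn_Ioi h1
  rw [← integrableOn_univ, ← Set.Iic_union_Ioi (a := (0 : ℝ))]
  exact h2.union h1

theorem summable_symbol {s : ℝ} (hs : 1 < s) (θ : ℝ) : Summable fun k : ℕ =>
    1 / ((k : ℝ) + 1) ^ s * (2 * (1 - Real.cos (((k : ℝ) + 1) * θ))) := by
  refine Summable.of_nonneg_of_le (fun k => ?_) (fun k => ?_)
    ((summable_one_div_succ_rpow hs).mul_right 4)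
  · have := Real.cos_le_one (((k : ℝ) + 1) * θ)
    exact mul_nonneg (by positivity) (by linarith)
  · have := Real.neg_one_le_cos (((k : ℝ) + 1) * θ)
    exact mul_le_mul_of_nonneg_left (by linarith) (by positivity)

/-- All terms are nonnegative, and the first alone suffices, as 1 - cos θ ≥ 2θ²/π² on [-π, π]. -/
theorem symbol_ge {s : ℝ} (hs : 1 < s) {θ : ℝ} (hθ : |θ| ≤ Real.pi) :
    4 / Real.pi ^ 2 * |θ| ^ 2 ≤ symbol s θ := by
  have h1 := (summable_symbol hs θ).le_tsum 0 (fun k _ => by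
    have := Real.cos_le_one (((k : ℝ) + 1) * θ)
    exact mul_nonneg (by positivity) (by linarith))
  have h2 := Real.cos_le_one_sub_mul_cos_sq hθ
  simp only [Nat.cast_zero, zero_add, Real.one_rpow, div_one, one_mul] at h1
  rw [symbol, sq_abs]
  have h3 : 4 / Real.pi ^ 2 * θ ^ 2 = 2 * (2 / Real.pi ^ 2 * θ ^ 2) := by ring
  linarith

theorem exists_symbol_ge_rpow {s α γ : ℝ} (hs : 1 < s) (hα : 0 < α) (hα2 : α ≤ 2) (hγ : 0 < γ)
    (hlim : Tendsto (fun θ => symbol s θ / |θ| ^ α) (𝓝[≠] 0) (𝓝 (γ ^ α))) :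
    ∃ c : ℝ, 0 < c ∧ ∀ θ, |θ| ≤ Real.pi → c * |θ| ^ α ≤ symbol s θ := by
  have hpos : 0 < γ ^ α := Real.rpow_pos_of_pos hγ α
  have h1 := hlim.eventually (lt_mem_nhds (half_lt_self hpos))
  rw [eventually_nhdsWithin_iff, Metric.eventually_nhds_iff] at h1
  obtain ⟨δ, hδ, h1⟩ := h1
  -- For |θ| < δ the quotient exceeds half its limit; for |θ| ≥ δ the quadratic bound and |θ|² ≥
  -- δ^{2-α} |θ|^α apply, which needs α ≤ 2.
  refine ⟨min (γ ^ α / 2) (4 / Real.pi ^ 2 * δ ^ (2 - α)), by positivity, fun θ hθ => ?_⟩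
  have hθα : 0 ≤ |θ| ^ α := by positivity
  rcases eq_or_ne θ 0 with rfl | h0
  · have := symbol_ge hs hθ
    simp only [abs_zero, Real.zero_rpow hα.ne', mul_zero]
    simpa using this
  have habs : 0 < |θ| := abs_pos.2 h0
  rcases lt_or_ge |θ| δ with hlt | hge
  · have := h1 (by simpa using hlt) h0
    rw [lt_div_iff₀ (by positivity)] at this
    exact (mul_le_mul_of_nonneg_right (min_le_left _ _) hθα).trans this.le
  · refine (mul_le_mul_of_nonneg_right (min_le_right _ _) hθα).trans
      (le_trans ?_ (symbol_ge hs hθ))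
    rw [mul_assoc]
    refine mul_le_mul_of_nonneg_left ?_ (by positivity)
    calc δ ^ (2 - α) * |θ| ^ α ≤ |θ| ^ (2 - α) * |θ| ^ α := by gcongr
      _ = |θ| ^ 2 := by
        rw [← Real.rpow_add habs, ← Real.rpow_natCast]
        norm_num

/-- The rescaled Fourier multiplier `e^{-λ^{-α} ω(λ z)}`, cut off to `|λ z| ≤ π`. -/
def scaledMultiplier (s α l z : ℝ) : ℝ :=
  (Set.Icc (-Real.pi) Real.pi).indicator (fun θ => Real.exp (-(l ^ (-α) * symbol s θ))) (l * z)

theorem measurable_scaledMultiplier {s : ℝ} (hs : 1 < s) (α l : ℝ) :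
    Measurable (scaledMultiplier s α l) := by
  have hc := continuous_symbol hs
  exact (Measurable.indicator (by fun_prop) measurableSet_Icc).comp (measurable_const_mul l)

/-- Homogeneity of |·|^α cancels `l`, leaving a dominating function independent of `l`. -/
theorem norm_scaledMultiplier_le {s α c l : ℝ} (hl : 0 < l)
    (hc : ∀ θ, |θ| ≤ Real.pi → c * |θ| ^ α ≤ symbol s θ) (z : ℝ) :
    ‖scaledMultiplier s α l z‖ ≤ Real.exp (-(c * |z| ^ α)) := by
  unfold scaledMultiplier
  by_cases h : l * z ∈ Set.Icc (-Real.pi) Real.pi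
  · rw [Set.indicator_of_mem h, Real.norm_of_nonneg (Real.exp_pos _).le, Real.exp_le_exp,
      neg_le_neg_iff]
    have h1 := hc (l * z) (abs_le.2 h)
    calc c * |z| ^ α = l ^ (-α) * (c * |l * z| ^ α) := by
          rw [abs_mul, abs_of_pos hl, Real.mul_rpow hl.le (abs_nonneg _), Real.rpow_neg hl.le]
          field_simp
      _ ≤ _ := mul_le_mul_of_nonneg_left h1 (by positivity)
  · rw [Set.indicator_of_notMem h, norm_zero]
    exact (Real.exp_pos _).le

theorem tendsto_scaledMultiplier {s α γ : ℝ} (hα : 0 < α) (hγ : 0 < γ)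
    (hlim : Tendsto (fun θ => symbol s θ / |θ| ^ α) (𝓝[≠] 0) (𝓝 (γ ^ α))) (z : ℝ) :
    Tendsto (fun l => scaledMultiplier s α l z) (𝓝[>] 0) (𝓝 (Real.exp (-(|γ * z| ^ α)))) := by
  have hz0 : Tendsto (fun l : ℝ => l * z) (𝓝[>] 0) (𝓝 0) := by
    have : Tendsto (fun l : ℝ => l * z) (𝓝 0) (𝓝 (0 * z)) := (continuous_mul_const z).tendsto 0
    rw [zero_mul] at this
    exact this.mono_left nhdsWithin_le_nhds
  have hmem : ∀ᶠ l : ℝ in 𝓝[>] 0, l * z ∈ Set.Icc (-Real.pi) Real.pi :=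
    hz0.eventually (Icc_mem_nhds (by linarith [Real.pi_pos]) Real.pi_pos)
  have hmain : Tendsto (fun l : ℝ => l ^ (-α) * symbol s (l * z)) (𝓝[>] 0)
      (𝓝 (|γ * z| ^ α)) := by
    -- The hypothesis only concerns a punctured neighbourhood of 0, so z = 0 is checked directly.
    rcases eq_or_ne z 0 with rfl | hz
    · simp [symbol, Real.zero_rpow hα.ne']
    have h1 : Tendsto (fun l : ℝ => l * z) (𝓝[>] 0) (𝓝[≠] 0) := by
      refine tendsto_nhdsWithin_iff.2 ⟨hz0, ?_⟩
      filter_upwards [self_mem_nhdsWithin] with l hl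
      exact mul_ne_zero (ne_of_gt hl) hz
    have h2 := (hlim.comp h1).mul_const (|z| ^ α)
    rw [abs_mul, abs_of_pos hγ, Real.mul_rpow hγ.le (abs_nonneg _)]
    refine h2.congr' ?_
    filter_upwards [self_mem_nhdsWithin] with l hl
    have hl : 0 < l := hl
    have : 0 < |z| := abs_pos.2 hz
    simp only [Function.comp]
    rw [abs_mul, abs_of_pos hl, Real.mul_rpow hl.le (abs_nonneg _), Real.rpow_neg hl.le]
    field_simp
  have h3 : Tendsto (fun l : ℝ => Real.exp (-(l ^ (-α) * symbol s (l * z)))) (𝓝[>] 0)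
      (𝓝 (Real.exp (-(|γ * z| ^ α)))) := (Real.continuous_exp.tendsto _).comp hmain.neg
  refine h3.congr' ?_
  filter_upwards [hmem] with l hl
  rw [scaledMultiplier, Set.indicator_of_mem hl]

theorem tendsto_integral_scaledMultiplier {s α γ : ℝ} (hs : 1 < s) (hα : 0 < α) (hα2 : α ≤ 2)
    (hγ : 0 < γ) (hlim : Tendsto (fun θ => symbol s θ / |θ| ^ α) (𝓝[≠] 0) (𝓝 (γ ^ α))) :
    Tendsto (fun l => ∫ z, ‖scaledMultiplier s α l z - Real.exp (-(|γ * z| ^ α))‖) (𝓝[>] 0)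
      (𝓝 0) := by
  obtain ⟨c, hc0, hc⟩ := exists_symbol_ge_rpow hs hα hα2 hγ hlim
  have hγα : ∀ z, |γ * z| ^ α = γ ^ α * |z| ^ α := fun z => by
    rw [abs_mul, abs_of_pos hγ, Real.mul_rpow hγ.le (abs_nonneg _)]
  have hint : Integrable fun z : ℝ => Real.exp (-(c * |z| ^ α)) + Real.exp (-(|γ * z| ^ α)) := by
    simp only [hγα]
    exact (integrable_exp_neg_mul_abs_rpow hα hc0).add
      (integrable_exp_neg_mul_abs_rpow hα (Real.rpow_pos_of_pos hγ α))
  have h := tendsto_integral_filter_of_dominated_convergence (μ := volume) (l := 𝓝[>] (0 : ℝ))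
    (F := fun l z => ‖scaledMultiplier s α l z - Real.exp (-(|γ * z| ^ α))‖) (f := fun _ => 0)
    _ ?_ ?_ hint ?_
  · simpa using h
  · refine Eventually.of_forall fun l => ?_
    have := measurable_scaledMultiplier hs α l
    have : Measurable fun z => ‖scaledMultiplier s α l z - Real.exp (-(|γ * z| ^ α))‖ := by
      fun_prop
    exact this.aestronglyMeasurable
  · filter_upwards [self_mem_nhdsWithin] with l hl
    refine Eventually.of_forall fun z => ?_
    rw [norm_norm]
    refine (norm_sub_le _ _).trans (add_le_add (norm_scaledMultiplier_le hl hc z) ?_)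
    rw [Real.norm_of_nonneg (Real.exp_pos _).le]
  · refine Eventually.of_forall fun z => ?_
    have := ((tendsto_scaledMultiplier hα hγ hlim z).sub_const
      (Real.exp (-(|γ * z| ^ α)))).norm
    simpa using this

theorem stableCharFun_symm (z α γ : ℝ) :
    stableCharFun z α 0 γ 0 = ((Real.exp (-(|γ * z| ^ α)) : ℝ) : ℂ) := by
  simp [stableCharFun]

theorem hasStableAsymptotics_of_symbol {s α γ : ℝ} (hs : 1 < s) {u : ℝ → EllTwo}
    (hu : IsSolution (mellinLaplacian s) e0 u) (hα : 0 < α) (hα2 : α ≤ 2) (hγ : 0 < γ)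
    (hlim : Tendsto (fun θ => symbol s θ / |θ| ^ α) (𝓝[≠] 0) (𝓝 (γ ^ α))) :
    HasStableAsymptotics u α γ := by
  obtain ⟨c, hc0, hc⟩ := exists_symbol_ge_rpow hs hα hα2 hγ hlim
  intro ε hε
  have hscale : Tendsto (fun t : ℝ => t ^ (-(1 / α))) atTop (𝓝[>] 0) := by
    refine tendsto_nhdsWithin_iff.2 ⟨tendsto_rpow_neg_atTop (by positivity), ?_⟩
    filter_upwards [eventually_gt_atTop 0] with t ht
    exact Real.rpow_pos_of_pos ht _
  have hev := ((tendsto_integral_scaledMultiplier hs hα hα2 hγ hlim).comp hscale).eventually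
    (gt_mem_nhds hε)
  obtain ⟨T, hT⟩ := eventually_atTop.1 hev
  refine ⟨max T 1, by positivity, fun t ht x => ?_⟩
  have ht0 : 0 < t := lt_of_lt_of_le one_pos ((le_max_right _ _).trans ht)
  have hE := hT t ((le_max_left _ _).trans ht)
  simp only [Function.comp] at hE
  set l := t ^ (-(1 / α)) with hl
  have hl0 : 0 < l := Real.rpow_pos_of_pos ht0 _
  have hlt : l ^ (-α) = t := by
    rw [hl, ← Real.rpow_mul ht0.le]
    have : -(1 / α) * -α = 1 := by field_simp
    rw [this, Real.rpow_one]
  have hexp : ∀ z : ℝ, ‖Complex.exp (Complex.I * ((l * x : ℝ) : ℂ) * z)‖ = 1 := fun z => by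
    rw [mul_assoc, mul_comm, ← Complex.ofReal_mul]
    exact Complex.norm_exp_ofReal_mul_I _
  -- The substitution θ = l z; the cutoff in the multiplier encodes the interval [-π, π].
  have h1 : u t x = (1 / (2 * Real.pi) : ℂ) * ((l : ℂ) *
      ∫ z : ℝ, (scaledMultiplier s α l z : ℂ) *
        Complex.exp (Complex.I * ((l * x : ℝ) : ℂ) * z)) := by
    rw [solution_apply hs hu ht0.le, intervalIntegral.integral_of_le (by linarith [Real.pi_pos]),
      ← integral_Icc_eq_integral_Ioc, ← integral_indicator measurableSet_Icc]
    congr 1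
    have h := Measure.integral_comp_mul_left ((Set.Icc (-Real.pi) Real.pi).indicator (fun θ : ℝ =>
      Complex.exp (-(t * symbol s θ : ℝ)) * Complex.exp (Complex.I * (x : ℂ) * (θ : ℂ)))) l
    rw [abs_of_pos (inv_pos.2 hl0), Complex.real_smul] at h
    have h' : ∀ a b : ℂ, a = ((l⁻¹ : ℝ) : ℂ) * b → b = l * a := by
      intro a b hab
      have : (l : ℂ) ≠ 0 := by exact_mod_cast hl0.ne'
      rw [hab]
      push_cast
      field_simp
    rw [h' _ _ h]
    congr 2
    funext z
    unfold scaledMultiplier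
    by_cases hz : l * z ∈ Set.Icc (-Real.pi) Real.pi
    · rw [Set.indicator_of_mem hz, Set.indicator_of_mem hz, hlt]
      push_cast
      congr 2
      ring
    · rw [Set.indicator_of_notMem hz, Set.indicator_of_notMem hz]
      simp
  have hi1 : Integrable fun z : ℝ => (scaledMultiplier s α l z : ℂ) *
        Complex.exp (Complex.I * ((l * x : ℝ) : ℂ) * z) := by
    have hm := measurable_scaledMultiplier hs α l
    have hm2 : Measurable fun z : ℝ => (scaledMultiplier s α l z : ℂ) *
        Complex.exp (Complex.I * ((l * x : ℝ) : ℂ) * z) := by fun_prop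
    refine (integrable_exp_neg_mul_abs_rpow hα hc0).mono' hm2.aestronglyMeasurable
      (Eventually.of_forall fun z => ?_)
    rw [norm_mul, hexp, mul_one, Complex.norm_real]
    exact norm_scaledMultiplier_le hl0 hc z
  have hi2 : Integrable fun z : ℝ => ((Real.exp (-(|γ * z| ^ α)) : ℝ) : ℂ) *
        Complex.exp (Complex.I * ((l * x : ℝ) : ℂ) * z) := by
    have hm2 : Measurable fun z : ℝ => ((Real.exp (-(|γ * z| ^ α)) : ℝ) : ℂ) *
        Complex.exp (Complex.I * ((l * x : ℝ) : ℂ) * z) := by fun_prop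
    refine (integrable_exp_neg_mul_abs_rpow hα (Real.rpow_pos_of_pos hγ α)).mono'
      hm2.aestronglyMeasurable (Eventually.of_forall fun z => ?_)
    rw [norm_mul, hexp, mul_one, Complex.norm_real, Real.norm_of_nonneg (Real.exp_pos _).le,
      abs_mul, abs_of_pos hγ, Real.mul_rpow hγ.le (abs_nonneg _)]
  have h2 : u t x - ((l * stableDensity (l * x) α 0 γ 0 : ℝ) : ℂ) =
      (1 / (2 * Real.pi) : ℂ) * ((l : ℂ) * ∫ z : ℝ,
        ((scaledMultiplier s α l z - Real.exp (-(|γ * z| ^ α)) : ℝ) : ℂ) *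
          Complex.exp (Complex.I * ((l * x : ℝ) : ℂ) * z)) := by
    rw [h1, Complex.ofReal_mul l (stableDensity _ _ _ _ _), stableDensity_eq_integral]
    simp only [stableCharFun_symm]
    have h3 := integral_sub hi1 hi2
    simp only [← sub_mul, ← Complex.ofReal_sub] at h3
    rw [h3]
    ring
  rw [h2, norm_mul, norm_mul, Complex.norm_real, Real.norm_of_nonneg hl0.le]
  have h3 : ‖∫ z : ℝ, ((scaledMultiplier s α l z - Real.exp (-(|γ * z| ^ α)) : ℝ) : ℂ) *
          Complex.exp (Complex.I * ((l * x : ℝ) : ℂ) * z)‖ ≤ ε := by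
    refine (norm_integral_le_integral_norm _).trans (le_trans (le_of_eq ?_) hE.le)
    congr 1
    funext z
    rw [norm_mul, hexp, mul_one, Complex.norm_real]
  have h4 : ‖(1 / (2 * Real.pi) : ℂ)‖ ≤ 1 := by
    have : (1 / (2 * Real.pi) : ℂ) = ((1 / (2 * Real.pi) : ℝ) : ℂ) := by push_cast; rfl
    rw [this, Complex.norm_real, Real.norm_of_nonneg (by positivity),
      div_le_one (by positivity)]
    linarith [Real.pi_gt_three]
  calc _ ≤ 1 * (l * ε) := by gcongr
    _ = ε * l := by ring

/-! ### The symbol near the origin: finite second moment -/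

/-- The sinc form isolates the factor x²; what remains is at most 1 and tends to 1 at the origin, as
dominated convergence for the series requires. -/
theorem two_mul_one_sub_cos_eq (x : ℝ) :
    2 * (1 - Real.cos x) = x ^ 2 * Real.sinc (x / 2) ^ 2 := by
  rcases eq_or_ne x 0 with rfl | hx
  · simp
  have h := Real.sin_sq_eq_half_sub (x / 2)
  rw [Real.sinc_of_ne_zero (by positivity), div_pow, h, mul_div_cancel₀ x two_ne_zero]
  field_simp

theorem tendsto_symbol_div_sq {s : ℝ} (hs : 3 < s) :
    Tendsto (fun θ => symbol s θ / |θ| ^ (2 : ℝ)) (𝓝[≠] 0)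
      (𝓝 (∑' k : ℕ, 1 / ((k : ℝ) + 1) ^ (s - 2))) := by
  have key : Tendsto (fun θ => ∑' k : ℕ, 1 / ((k : ℝ) + 1) ^ (s - 2) *
      Real.sinc ((((k : ℝ) + 1) * θ) / 2) ^ 2) (𝓝[≠] 0)
      (𝓝 (∑' k : ℕ, 1 / ((k : ℝ) + 1) ^ (s - 2))) := by
    refine tendsto_tsum_of_dominated_convergence
      (summable_one_div_succ_rpow (s := s - 2) (by linarith)) (fun k => ?_)
      (Eventually.of_forall fun θ k => ?_)
    · have hc : Continuous fun θ : ℝ => 1 / ((k : ℝ) + 1) ^ (s - 2) *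
          Real.sinc ((((k : ℝ) + 1) * θ) / 2) ^ 2 := by
        have := Real.continuous_sinc
        fun_prop
      have h := hc.tendsto 0
      simp only [mul_zero, zero_div, Real.sinc_zero, one_pow, mul_one] at h
      exact h.mono_left nhdsWithin_le_nhds
    · rw [norm_mul, Real.norm_of_nonneg (by positivity), norm_pow]
      refine mul_le_of_le_one_right (by positivity) (pow_le_one₀ (norm_nonneg _) ?_)
      exact Real.abs_sinc_le_one _
  refine key.congr' ?_
  filter_upwards [self_mem_nhdsWithin] with θ hθ
  have hθ : θ ≠ 0 := hθ
  rw [symbol, ← tsum_div_const]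
  refine tsum_congr fun k => ?_
  have hk : (0 : ℝ) < (k : ℝ) + 1 := by positivity
  rw [two_mul_one_sub_cos_eq, Real.rpow_sub hk, Real.rpow_two, Real.rpow_two, sq_abs]
  field_simp

theorem re_riemannZeta_eq_tsum {σ : ℝ} (hσ : 1 < σ) :
    (riemannZeta (σ : ℂ)).re = ∑' k : ℕ, 1 / ((k : ℝ) + 1) ^ σ := by
  rw [zeta_eq_tsum_one_div_nat_add_one_cpow (by simpa using hσ), ← Complex.ofReal_re (∑' k : ℕ, _),
    Complex.ofReal_tsum]
  congr 2
  funext k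
  have hk : (0 : ℝ) ≤ (k : ℝ) + 1 := by positivity
  rw [Complex.ofReal_div, Complex.ofReal_cpow hk]
  push_cast
  rfl

/-! ### The symbol near the origin: heavy tails -/

theorem two_mul_one_sub_cos_nonneg (x : ℝ) : 0 ≤ 2 * (1 - Real.cos x) := by
  linarith [Real.cos_le_one x]

/-- A dominating function for the step functions `y ↦ 2 (1 - cos r(y)) r(y)^{-s}`. -/
def stepBound (s y : ℝ) : ℝ :=
  (Set.Ioc 0 1).indicator (fun y => y ^ (2 - s) + 2) y +
    (Set.Ioi 1).indicator (fun y => 4 * y ^ (-s)) y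

theorem integrable_stepBound {s : ℝ} (hs : 1 < s) (hs3 : s < 3) : Integrable (stepBound s) := by
  refine Integrable.add ?_ ?_
  · rw [integrable_indicator_iff measurableSet_Ioc,
      ← intervalIntegrable_iff_integrableOn_Ioc_of_le zero_le_one]
    exact (intervalIntegral.intervalIntegrable_rpow' (by linarith)).add
      intervalIntegrable_const
  · rw [integrable_indicator_iff measurableSet_Ioi]
    exact (integrableOn_Ioi_rpow_of_lt (by linarith) one_pos).const_mul 4

theorem le_stepBound {s : ℝ} (hs : 1 < s) {y r : ℝ} (hy : 0 < y) (hr : y ≤ r)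
    (hr1 : r ≤ y + 1) : 2 * (1 - Real.cos r) * r ^ (-s) ≤ stepBound s y := by
  have hr0 : 0 < r := hy.trans_le hr
  rcases le_or_gt y 1 with h | h
  · have hmem : y ∈ Set.Ioc (0 : ℝ) 1 := ⟨hy, h⟩
    have hnot : y ∉ Set.Ioi (1 : ℝ) := not_lt.2 h
    rw [stepBound, Set.indicator_of_mem hmem, Set.indicator_of_notMem hnot, add_zero]
    have h1 : 2 * (1 - Real.cos r) ≤ r ^ 2 := by
      linarith [Real.one_sub_sq_div_two_le_cos (x := r)]
    have h2 : 2 * (1 - Real.cos r) * r ^ (-s) ≤ r ^ (2 - s) := by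
      calc _ ≤ r ^ 2 * r ^ (-s) := by gcongr
        _ = r ^ (2 - s) := by
          rw [← Real.rpow_two, ← Real.rpow_add hr0, sub_eq_add_neg]
    refine h2.trans ?_
    have hpos : 0 < y ^ (2 - s) := Real.rpow_pos_of_pos hy _
    -- For s ≤ 2 the power r^{2-s} is bounded because r ≤ 2, which accounts for the summand 2 in
    -- `stepBound`; for s > 2 it is decreasing in r.
    rcases le_or_gt s 2 with h3 | h3
    · have : r ^ (2 - s) ≤ 2 := by
        calc r ^ (2 - s) ≤ 2 ^ (2 - s) := by gcongr; linarith
          _ ≤ 2 ^ (1 : ℝ) := Real.rpow_le_rpow_of_exponent_le one_le_two (by linarith)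
          _ = 2 := Real.rpow_one 2
      linarith
    · have := Real.rpow_le_rpow_of_nonpos hy hr (by linarith : 2 - s ≤ 0)
      linarith
  · have hmem : y ∉ Set.Ioc (0 : ℝ) 1 := fun h' => absurd h'.2 (not_le.2 h)
    rw [stepBound, Set.indicator_of_notMem hmem, Set.indicator_of_mem (Set.mem_Ioi.2 h), zero_add]
    have h1 : 2 * (1 - Real.cos r) ≤ 4 := by linarith [Real.neg_one_le_cos r]
    exact mul_le_mul h1 (Real.rpow_le_rpow_of_nonpos hy hr (by linarith)) (by positivity)
      (by norm_num)

theorem integrableOn_one_sub_cos_mul_rpow {s : ℝ} (hs : 1 < s) (hs3 : s < 3) :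
    IntegrableOn (fun y : ℝ => 2 * (1 - Real.cos y) * y ^ (-s)) (Set.Ioi 0) := by
  refine (integrable_stepBound hs hs3).integrableOn.mono' ?_ ?_
  · exact (by fun_prop : Measurable _).aestronglyMeasurable
  · refine (ae_restrict_mem measurableSet_Ioi).mono fun y hy => ?_
    have hy : 0 < y := hy
    rw [Real.norm_of_nonneg (mul_nonneg (two_mul_one_sub_cos_nonneg y) (by positivity))]
    exact le_stepBound hs hy le_rfl (by linarith)

/-- The right-hand integrand is constant on [θk, θ(k+1)), with its value taken at the right endpoint
θ(k+1). The integral is therefore a right-endpoint Riemann sum, and the mesh θ supplies the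
remaining power of θ. -/
theorem symbol_div_rpow_eq_integral {s : ℝ} (hs : 1 < s) (hs3 : s < 3) {θ : ℝ} (hθ : 0 < θ)
    (hθ1 : θ ≤ 1) :
    symbol s θ / θ ^ (s - 1) = ∫ y in Set.Ioi 0, 2 * (1 - Real.cos (θ * (⌊y / θ⌋₊ + 1))) *
      (θ * ((⌊y / θ⌋₊ : ℝ) + 1)) ^ (-s) := by
  set F : ℝ → ℝ := fun y => 2 * (1 - Real.cos (θ * (⌊y / θ⌋₊ + 1))) *
      (θ * ((⌊y / θ⌋₊ : ℝ) + 1)) ^ (-s) with hF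
  have hfloor : ∀ (k : ℕ) (y : ℝ), y ∈ Set.Ico (θ * k) (θ * (k + 1)) → ⌊y / θ⌋₊ = k := by
    intro k y hy
    have hy0 : 0 ≤ y := le_trans (by positivity) hy.1
    rw [Nat.floor_eq_iff (by positivity), le_div_iff₀ hθ, div_lt_iff₀ hθ]
    exact ⟨by linarith [hy.1], by linarith [hy.2]⟩
  have hunion : (⋃ k : ℕ, Set.Ico (θ * (k : ℝ)) (θ * (k + 1))) = Set.Ici 0 := by
    ext y
    simp only [Set.mem_iUnion, Set.mem_Ici]
    constructor
    · rintro ⟨k, hk⟩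
      exact le_trans (by positivity) hk.1
    · intro hy
      refine ⟨⌊y / θ⌋₊, ?_, ?_⟩
      · have := Nat.floor_le (show 0 ≤ y / θ by positivity)
        rw [le_div_iff₀ hθ] at this
        linarith
      · have := Nat.lt_floor_add_one (y / θ)
        rw [div_lt_iff₀ hθ] at this
        linarith
  have hint : IntegrableOn F (Set.Ioi 0) := by
    refine (integrable_stepBound hs hs3).integrableOn.mono' ?_ ?_
    · exact (by fun_prop : Measurable F).aestronglyMeasurable
    · refine (ae_restrict_mem measurableSet_Ioi).mono fun y hy => ?_
      have hy : 0 < y := hy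
      rw [Real.norm_of_nonneg (mul_nonneg (two_mul_one_sub_cos_nonneg _) (by positivity))]
      have h1 := Nat.floor_le (show 0 ≤ y / θ by positivity)
      have h2 := Nat.lt_floor_add_one (y / θ)
      rw [le_div_iff₀ hθ] at h1
      rw [div_lt_iff₀ hθ] at h2
      exact le_stepBound hs hy (by linarith) (by linarith)
  have hsum := hasSum_integral_iUnion (μ := volume) (f := F)
    (s := fun k : ℕ => Set.Ico (θ * (k : ℝ)) (θ * (k + 1))) (fun _ => measurableSet_Ico) ?_
    (by rw [hunion]; exact Iff.mpr integrableOn_Ici_iff_integrableOn_Ioi hint)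
  · rw [hunion, integral_Ici_eq_integral_Ioi] at hsum
    rw [← hsum.tsum_eq, symbol, ← tsum_div_const]
    refine tsum_congr fun k => ?_
    have hk : (0 : ℝ) < (k : ℝ) + 1 := by positivity
    rw [setIntegral_congr_fun (g := fun _ => 2 * (1 - Real.cos (θ * ((k : ℝ) + 1))) *
      (θ * ((k : ℝ) + 1)) ^ (-s)) measurableSet_Ico
      (fun y hy => by simp only [hF, hfloor k y hy])]
    rw [setIntegral_const, measureReal_def, Real.volume_Ico,
      ENNReal.toReal_ofReal (by linarith), smul_eq_mul, Real.mul_rpow hθ.le hk.le,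
      Real.rpow_sub hθ, Real.rpow_one, Real.rpow_neg hθ.le, Real.rpow_neg hk.le,
      mul_comm ((k : ℝ) + 1) θ]
    field_simp
    ring
  · intro i j hij
    refine Set.disjoint_left.2 fun y hi hj => hij ?_
    rw [← hfloor i y hi, hfloor j y hj]

theorem tendsto_symbol_div_rpow {s : ℝ} (hs : 1 < s) (hs3 : s < 3) :
    Tendsto (fun θ => symbol s θ / |θ| ^ (s - 1)) (𝓝[≠] 0)
      (𝓝 (∫ y in Set.Ioi 0, 2 * (1 - Real.cos y) * y ^ (-s))) := by
  have hpos : Tendsto (fun θ => symbol s θ / θ ^ (s - 1)) (𝓝[>] 0)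
      (𝓝 (∫ y in Set.Ioi 0, 2 * (1 - Real.cos y) * y ^ (-s))) := by
    have hle : ∀ᶠ θ : ℝ in 𝓝[>] 0, θ ≤ 1 :=
      mem_nhdsWithin_of_mem_nhds (Iic_mem_nhds one_pos)
    have h := tendsto_integral_filter_of_dominated_convergence
      (μ := volume.restrict (Set.Ioi 0)) (l := 𝓝[>] (0 : ℝ))
      (F := fun θ y => 2 * (1 - Real.cos (θ * (⌊y / θ⌋₊ + 1))) *
        (θ * ((⌊y / θ⌋₊ : ℝ) + 1)) ^ (-s))
      (f := fun y => 2 * (1 - Real.cos y) * y ^ (-s)) (stepBound s) ?_ ?_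
      (integrable_stepBound hs hs3).integrableOn ?_
    · refine h.congr' ?_
      filter_upwards [self_mem_nhdsWithin, hle] with θ h0 h1
      exact (symbol_div_rpow_eq_integral hs hs3 h0 h1).symm
    · exact Eventually.of_forall fun θ => (by fun_prop : Measurable _).aestronglyMeasurable
    · filter_upwards [self_mem_nhdsWithin, hle] with θ hθ hθ1
      have hθ : 0 < θ := hθ
      refine (ae_restrict_mem measurableSet_Ioi).mono fun y hy => ?_
      have hy : 0 < y := hy
      rw [Real.norm_of_nonneg (mul_nonneg (two_mul_one_sub_cos_nonneg _) (by positivity))]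
      have h1 := Nat.floor_le (show 0 ≤ y / θ by positivity)
      have h2 := Nat.lt_floor_add_one (y / θ)
      rw [le_div_iff₀ hθ] at h1
      rw [div_lt_iff₀ hθ] at h2
      exact le_stepBound hs hy (by linarith) (by linarith)
    · refine (ae_restrict_mem measurableSet_Ioi).mono fun y hy => ?_
      have hy : 0 < y := hy
      -- The node attached to y lies between y and y + θ.
      have hr : Tendsto (fun θ : ℝ => θ * ((⌊y / θ⌋₊ : ℝ) + 1)) (𝓝[>] 0) (𝓝 y) := by
        refine tendsto_of_tendsto_of_tendsto_of_le_of_le' tendsto_const_nhds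
          (h := fun θ => y + θ) ?_ ?_ ?_
        · have : Tendsto (fun θ : ℝ => y + θ) (𝓝 0) (𝓝 (y + 0)) :=
            (continuous_const_add y).tendsto 0
          rw [add_zero] at this
          exact this.mono_left nhdsWithin_le_nhds
        · filter_upwards [self_mem_nhdsWithin] with θ hθ
          have hθ : 0 < θ := hθ
          have h2 := Nat.lt_floor_add_one (y / θ)
          rw [div_lt_iff₀ hθ] at h2
          linarith
        · filter_upwards [self_mem_nhdsWithin] with θ hθ
          have hθ : 0 < θ := hθ
          have h1 := Nat.floor_le (show 0 ≤ y / θ by positivity)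
          rw [le_div_iff₀ hθ] at h1
          linarith
      have hc : ContinuousAt (fun y : ℝ => 2 * (1 - Real.cos y) * y ^ (-s)) y :=
        ContinuousAt.mul (by fun_prop) (Real.continuousAt_rpow_const _ _ (Or.inl hy.ne'))
      exact hc.tendsto.comp hr
  have habs : Tendsto (fun θ : ℝ => |θ|) (𝓝[≠] 0) (𝓝[>] 0) := tendsto_abs_nhdsNE_zero
  refine (hpos.comp habs).congr fun θ => ?_
  have : symbol s |θ| = symbol s θ := by
    rcases abs_choice θ with h | h <;> rw [h]
    simp [symbol]
  simp only [Function.comp, this]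

/-! ### The constant -/

/-- For a nonnegative kernel, integrability of one iterated integral already gives integrability on
the product. -/
theorem integral_Ioi_swap_of_nonneg {f : ℝ → ℝ → ℝ} (hm : Measurable (Function.uncurry f))
    (h0 : ∀ x > 0, ∀ y > 0, 0 ≤ f x y) (hI : ∀ x > 0, IntegrableOn (f x) (Set.Ioi 0))
    (hG : IntegrableOn (fun x => ∫ y in Set.Ioi 0, f x y) (Set.Ioi 0)) :
    ∫ x in Set.Ioi 0, ∫ y in Set.Ioi 0, f x y = ∫ y in Set.Ioi 0, ∫ x in Set.Ioi 0, f x y := by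
  refine integral_integral_swap ?_
  rw [integrable_prod_iff hm.aestronglyMeasurable]
  refine ⟨(ae_restrict_mem measurableSet_Ioi).mono fun x hx => hI x hx, ?_⟩
  refine hG.congr_fun (fun x hx => ?_) measurableSet_Ioi
  refine setIntegral_congr_fun measurableSet_Ioi fun y hy => ?_
  exact (Real.norm_of_nonneg (h0 x hx y hy)).symm

/-- Real part of ∫ e^{(-x+i)y} dy, subtracted from 1/x: the result is 1/x - x/(1+x²). -/
theorem integral_one_sub_cos_mul_exp {x : ℝ} (hx : 0 < x) :
    ∫ y in Set.Ioi 0, (1 - Real.cos y) * Real.exp (-(x * y)) = 1 / (x * (1 + x ^ 2)) := by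
  have ha : (-(x : ℂ) + Complex.I).re < 0 := by simpa using hx
  have h1 := integral_exp_mul_complex_Ioi ha 0
  have hi1 := integrableOn_exp_mul_complex_Ioi ha 0
  have h2 := integral_exp_mul_Ioi (neg_lt_zero.2 hx) 0
  have hi2 := integrableOn_exp_mul_Ioi (neg_lt_zero.2 hx) 0
  have h3 := congrArg Complex.re h1
  have hre : ∀ y : ℝ, (Complex.exp ((-(x : ℂ) + Complex.I) * y)).re =
      Real.cos y * Real.exp (-x * y) := fun y => by
    rw [Complex.exp_re]
    simp [mul_comm]
  rw [← Complex.reCLM_apply, ← ContinuousLinearMap.integral_comp_comm _ hi1] at h3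
  have hi3 := Complex.reCLM.integrable_comp hi1
  simp only [Complex.reCLM_apply, hre] at h3 hi3
  have h4 : ∀ y : ℝ, (1 - Real.cos y) * Real.exp (-(x * y)) =
      Real.exp (-x * y) - Real.cos y * Real.exp (-x * y) := fun y => by
    rw [neg_mul]; ring
  simp only [h4]
  rw [integral_sub hi2 hi3, h2, h3]
  simp [Complex.normSq_apply, Complex.div_re]
  have : 0 < 1 + x ^ 2 := by positivity
  have : x * x + 1 ≠ 0 := by positivity
  field_simp
  ring

/-- Write 1/(1+x²) = ∫_0^∞ e^{-w(1+x²)} dw. Integrating over x first gives Γ(a) e^{-w} w^{-a} with a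
= (s-1)/2 in (0,1), then w gives Γ(a) Γ(1-a). -/
theorem integral_rpow_div_one_add_sq {s : ℝ} (hs : 1 < s) (hs3 : s < 3) :
    ∫ x in Set.Ioi (0 : ℝ), 2 * x ^ (s - 2) / (1 + x ^ 2) =
      Real.pi / Real.sin (Real.pi * ((s - 1) / 2)) := by
  set a := (s - 1) / 2 with ha
  have ha0 : 0 < a := by rw [ha]; linarith
  have ha1 : 0 < 1 - a := by rw [ha]; linarith
  let f : ℝ → ℝ → ℝ := fun w x => 2 * x ^ (s - 2) * Real.exp (-(w * (1 + x ^ 2)))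
  have hf : ∀ w x, f w x = 2 * Real.exp (-w) * (x ^ (s - 2) * Real.exp (-w * x ^ (2 : ℝ))) := by
    intro w x
    have : -(w * (1 + x ^ 2)) = -w + -w * x ^ 2 := by ring
    simp only [f]
    rw [this, Real.exp_add, Real.rpow_two]
    ring
  have hinner : ∀ w > 0, ∫ x in Set.Ioi 0, f w x = Real.Gamma a *
      (Real.exp (-w) * w ^ ((1 - a) - 1)) := by
    intro w hw
    simp only [hf]
    rw [integral_const_mul, integral_rpow_mul_exp_neg_mul_rpow two_pos (by linarith) hw]
    have e1 : -(s - 2 + 1) / 2 = (1 - a) - 1 := by rw [ha]; ring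
    have e2 : (s - 2 + 1) / 2 = a := by rw [ha]; ring
    rw [e1, e2]
    ring
  have hswap := integral_Ioi_swap_of_nonneg (f := f) (by fun_prop)
    (fun w hw x hx => by have : 0 < x := hx; positivity) (fun w hw => ?_) ?_
  · rw [setIntegral_congr_fun measurableSet_Ioi hinner, integral_const_mul,
      ← Real.Gamma_eq_integral ha1, Real.Gamma_mul_Gamma_one_sub] at hswap
    rw [hswap]
    refine setIntegral_congr_fun measurableSet_Ioi fun x _ => ?_
    have hx : 0 < 1 + x ^ 2 := by positivity
    have h2 := integral_exp_mul_Ioi (neg_lt_zero.2 hx) 0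
    have h3 : ∀ w, f w x = 2 * x ^ (s - 2) * Real.exp (-(1 + x ^ 2) * w) := fun w => by
      simp only [f]; congr 2; ring
    simp only [h3]
    rw [integral_const_mul, h2, mul_zero, Real.exp_zero, neg_div_neg_eq, mul_one_div]
  · rw [show f w = _ from funext (hf w)]
    exact (integrableOn_rpow_mul_exp_neg_mul_rpow (by linarith) two_pos hw).const_mul _
  · refine IntegrableOn.congr_fun ?_ (fun w hw => (hinner w hw).symm) measurableSet_Ioi
    exact (Real.GammaIntegral_convergent ha1).const_mul _

/-- Replace Γ(s) y^{-s} by ∫_0^∞ x^{s-1} e^{-xy} dx; after exchanging the order, the y-integral is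
the Laplace transform of 1 - cos. -/
theorem integral_one_sub_cos_mul_rpow {s : ℝ} (hs : 1 < s) (hs3 : s < 3) :
    ∫ y in Set.Ioi 0, 2 * (1 - Real.cos y) * y ^ (-s) =
      -(Real.pi / (Real.Gamma s * Real.cos (Real.pi * s / 2))) := by
  have hs0 : 0 < s := by linarith
  let f : ℝ → ℝ → ℝ := fun y x => 2 * (1 - Real.cos y) * (x ^ (s - 1) * Real.exp (-(y * x)))
  have hinner : ∀ y > 0, ∫ x in Set.Ioi 0, f y x =
      Real.Gamma s * (2 * (1 - Real.cos y) * y ^ (-s)) := by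
    intro y hy
    simp only [f]
    rw [integral_const_mul, Real.integral_rpow_mul_exp_neg_mul_Ioi hs0 hy, Real.rpow_neg hy.le,
      one_div, Real.inv_rpow hy.le]
    ring
  have hswap := integral_Ioi_swap_of_nonneg (f := f) (by fun_prop)
    (fun y hy x hx => mul_nonneg (two_mul_one_sub_cos_nonneg y)
      (by have : 0 < x := hx; positivity)) (fun y hy => ?_) ?_
  · rw [setIntegral_congr_fun measurableSet_Ioi hinner, integral_const_mul] at hswap
    have h2 : ∀ x > 0, ∫ y in Set.Ioi 0, f y x = 2 * x ^ (s - 2) / (1 + x ^ 2) := by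
      intro x hx
      have h3 : ∀ y, f y x = 2 * x ^ (s - 1) * ((1 - Real.cos y) * Real.exp (-(x * y))) :=
        fun y => by simp only [f, mul_comm y x]; ring
      simp only [h3]
      have e1 : s - 1 = (s - 2) + 1 := by ring
      rw [integral_const_mul, integral_one_sub_cos_mul_exp hx, e1, Real.rpow_add_one hx.ne']
      have : 0 < 1 + x ^ 2 := by positivity
      field_simp
    rw [setIntegral_congr_fun measurableSet_Ioi h2, integral_rpow_div_one_add_sq hs hs3] at hswap
    have e2 : Real.sin (Real.pi * ((s - 1) / 2)) = -Real.cos (Real.pi * s / 2) := by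
      rw [← Real.sin_sub_pi_div_two]
      congr 1
      ring
    rw [e2, div_neg] at hswap
    rw [mul_comm, ← eq_div_iff (Real.Gamma_pos_of_pos hs0).ne'] at hswap
    rw [hswap, neg_div, div_div, mul_comm (Real.cos _)]
  · have h := integrableOn_rpow_mul_exp_neg_mul_rpow (s := s - 1) (by linarith) one_pos hy
    simp only [Real.rpow_one, neg_mul] at h
    exact h.const_mul _
  · refine IntegrableOn.congr_fun ?_ (fun y hy => (hinner y hy).symm) measurableSet_Ioi
    exact (integrableOn_one_sub_cos_mul_rpow hs hs3).const_mul _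

/-! ### The tail of the symmetric stable density -/

theorem image_exp_univ : Real.exp '' Set.univ = Set.Ioi 0 := by
  rw [Set.image_univ, Real.range_exp]

/-- In the coordinate z = e^x rays from the origin become horizontal lines and z^α becomes the
entire function e^{αw}, so rotating a contour needs no branch cuts. -/
theorem integral_comp_exp_mul {E : Type*} [NormedAddCommGroup E] [NormedSpace ℝ E] (f : ℝ → E) :
    ∫ z in Set.Ioi 0, f z = ∫ x : ℝ, Real.exp x • f (Real.exp x) := by
  have h := integral_image_eq_integral_abs_deriv_smul MeasurableSet.univ
    (fun x _ => (Real.hasDerivAt_exp x).hasDerivWithinAt) Real.exp_injective.injOn f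
  simpa only [image_exp_univ, Measure.restrict_univ, Real.abs_exp] using h

theorem integrable_comp_exp_mul_iff (f : ℝ → ℝ) :
    IntegrableOn f (Set.Ioi 0) ↔ Integrable fun x : ℝ => Real.exp x * f (Real.exp x) := by
  have h := integrableOn_image_iff_integrableOn_abs_deriv_smul MeasurableSet.univ
    (fun x _ => (Real.hasDerivAt_exp x).hasDerivWithinAt) Real.exp_injective.injOn f
  simpa only [image_exp_univ, integrableOn_univ, Real.abs_exp, smul_eq_mul] using h

theorem integrable_exp_neg_exp_add {κ β p : ℝ} (hκ : 0 < κ) (hβ : 0 < β) (hp : 0 < p) :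
    Integrable fun x : ℝ => Real.exp (-(κ * Real.exp (β * x)) + p * x) := by
  have h := (integrable_comp_exp_mul_iff _).1
    (integrableOn_rpow_mul_exp_neg_mul_rpow (s := p - 1) (by linarith) hβ hκ)
  refine h.congr (Eventually.of_forall fun x => ?_)
  simp only [← Real.exp_mul, ← Real.exp_add]
  congr 1
  rw [mul_comm x β]
  ring

theorem tendsto_exp_neg_exp_add_atBot {κ β p : ℝ} (hκ : 0 < κ) (hp : 0 < p) :
    Tendsto (fun x : ℝ => Real.exp (-(κ * Real.exp (β * x)) + p * x)) atBot (𝓝 0) := by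
  have h : Tendsto (fun x : ℝ => Real.exp (p * x)) atBot (𝓝 0) :=
    Real.tendsto_exp_atBot.comp (tendsto_id.const_mul_atBot hp)
  refine squeeze_zero (fun x => (Real.exp_pos _).le) (fun x => Real.exp_le_exp.2 ?_) h
  have : 0 < κ * Real.exp (β * x) := by positivity
  linarith

theorem tendsto_exp_neg_exp_add_atTop {κ β p : ℝ} (hκ : 0 < κ) (hβ : 0 < β) :
    Tendsto (fun x : ℝ => Real.exp (-(κ * Real.exp (β * x)) + p * x)) atTop (𝓝 0) := by
  have h := (tendsto_rpow_mul_exp_neg_mul_atTop_nhds_zero (p / β) κ hκ).comp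
    (Real.tendsto_exp_atTop.comp (tendsto_id.const_mul_atTop hβ))
  refine h.congr fun x => ?_
  simp only [Function.comp, id, ← Real.exp_mul, ← Real.exp_add]
  congr 1
  field_simp
  ring

/-- Shifting a horizontal line of integration in a strip where the integrand decays doubly
exponentially to the right and exponentially to the left. -/
theorem integral_horizontal_shift {G : ℂ → ℂ} (hG : Differentiable ℂ G) {κ β p a b : ℝ}
    (hκ : 0 < κ) (hβ : 0 < β) (hp : 0 < p) (hab : a ≤ b)
    (hbound : ∀ x : ℝ, ∀ y ∈ Set.Icc a b,
      ‖G (x + y * Complex.I)‖ ≤ Real.exp (-(κ * Real.exp (β * x)) + p * x)) :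
    ∫ x : ℝ, G (x + a * Complex.I) = ∫ x : ℝ, G (x + b * Complex.I) := by
  have hint : ∀ y ∈ Set.Icc a b, Integrable fun x : ℝ => G (x + y * Complex.I) := by
    intro y hy
    refine (integrable_exp_neg_exp_add hκ hβ hp).mono' ?_
      (Eventually.of_forall fun x => hbound x y hy)
    have hc := hG.continuous
    exact (by fun_prop : Continuous _).aestronglyMeasurable
  have hlim : ∀ y ∈ Set.Icc a b, Tendsto (fun R : ℝ => ∫ x : ℝ in -R..R, G (x + y * Complex.I))
      atTop (𝓝 (∫ x : ℝ, G (x + y * Complex.I))) := fun y hy =>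
    intervalIntegral_tendsto_integral (hint y hy) tendsto_neg_atTop_atBot tendsto_id
  have hvert : ∀ {φ : ℝ → ℝ}, Tendsto (fun R => Real.exp (-(κ * Real.exp (β * φ R)) + p * φ R))
      atTop (𝓝 0) → Tendsto (fun R : ℝ => Complex.I • ∫ y : ℝ in a..b,
        G ((φ R : ℂ) + y * Complex.I)) atTop (𝓝 0) := by
    intro φ hφ
    have h0 := hφ.mul_const |b - a|
    rw [zero_mul] at h0
    refine squeeze_zero_norm (fun R => ?_) h0
    rw [norm_smul, Complex.norm_I, one_mul]
    refine intervalIntegral.norm_integral_le_of_norm_le_const fun y hy => ?_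
    rw [Set.uIoc_of_le hab] at hy
    exact hbound _ y (Set.Ioc_subset_Icc_self hy)
  have hv1 := hvert (φ := fun R => R) (tendsto_exp_neg_exp_add_atTop hκ hβ)
  have hv2 := hvert (φ := fun R => -R)
    ((tendsto_exp_neg_exp_add_atBot hκ hp).comp tendsto_neg_atTop_atBot)
  -- Cauchy's theorem on [-R, R] × [a, b]; the vertical sides vanish in the limit by `hv1` and
  -- `hv2`.
  have hrect : ∀ R : ℝ, (∫ x : ℝ in -R..R, G (x + a * Complex.I)) -
      (∫ x : ℝ in -R..R, G (x + b * Complex.I)) +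
      Complex.I • (∫ y : ℝ in a..b, G ((R : ℂ) + y * Complex.I)) -
      Complex.I • (∫ y : ℝ in a..b, G (((-R : ℝ) : ℂ) + y * Complex.I)) = 0 := by
    intro R
    have h := Complex.integral_boundary_rect_eq_zero_of_differentiableOn G
      ⟨-R, a⟩ ⟨R, b⟩ hG.differentiableOn
    simpa using h
  have htot := (((hlim a ⟨le_rfl, hab⟩).sub (hlim b ⟨hab, le_rfl⟩)).add hv1).sub hv2
  simp only [hrect, add_zero, sub_zero] at htot
  exact sub_eq_zero.1 (tendsto_nhds_unique htot tendsto_const_nhds)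

theorem exp_add_mul_I (x y : ℝ) : Complex.exp (x + y * Complex.I) =
    ((Real.exp x * Real.cos y : ℝ) : ℂ) + ((Real.exp x * Real.sin y : ℝ) : ℂ) * Complex.I := by
  rw [Complex.exp_add, Complex.exp_mul_I]
  push_cast
  ring

/-- The form `1 * x` matches the bound of `integral_horizontal_shift` with β = 1. -/
theorem norm_exp_I_mul_exp_add (p x y : ℝ) :
    ‖Complex.exp (Complex.I * Complex.exp (x + y * Complex.I) + p * (x + y * Complex.I))‖ =
      Real.exp (-(Real.sin y * Real.exp (1 * x)) + p * x) := by
  rw [Complex.norm_exp, exp_add_mul_I]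
  congr 1
  simp [-Complex.ofReal_mul]
  ring

/-- Euler's integral for the Gamma function along the ray of argument `π / 4`. -/
theorem integral_exp_I_mul_exp_add {p : ℝ} (hp : 0 < p) :
    ∫ x : ℝ, Complex.exp (Complex.I * Complex.exp (x + (Real.pi / 4 : ℝ) * Complex.I) +
      p * (x + (Real.pi / 4 : ℝ) * Complex.I)) =
      Complex.exp (p * (Real.pi / 2 : ℝ) * Complex.I) * Real.Gamma p := by
  have hpi := Real.pi_pos
  have hsin : 0 < Real.sin (Real.pi / 4) :=
    Real.sin_pos_of_pos_of_lt_pi (by positivity) (by linarith)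
  -- On the line of height π/2 one has i e^w = -e^x, which is Euler's integral. Between the two
  -- heights sin y ≥ sin(π/4), which gives the decay.
  rw [integral_horizontal_shift (b := Real.pi / 2)
    (G := fun w => Complex.exp (Complex.I * Complex.exp w + p * w)) (by fun_prop)
    hsin one_pos hp (by linarith)]
  · rw [Real.Gamma_eq_integral hp, integral_comp_exp_mul, ← integral_complex_ofReal,
      ← integral_const_mul]
    congr 1
    funext x
    have h1 : Complex.exp (x + ((Real.pi / 2 : ℝ) : ℂ) * Complex.I) = Real.exp x * Complex.I := by
      rw [exp_add_mul_I]; simp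
    rw [h1]
    simp only [smul_eq_mul, ← Real.exp_mul, ← Real.exp_add, Complex.ofReal_exp]
    rw [← Complex.exp_add]
    congr 1
    push_cast
    linear_combination Complex.exp x * Complex.I_sq
  · intro x y hy
    rw [norm_exp_I_mul_exp_add, Real.exp_le_exp]
    have : Real.sin (Real.pi / 4) ≤ Real.sin y :=
      Real.sin_le_sin_of_le_of_le_pi_div_two (by linarith) hy.2 hy.1
    have h2 := Real.exp_pos (1 * x)
    nlinarith

/-- Mean value inequality on the convex half-plane Re ≤ 0, where the derivative of exp has norm at
most 1. -/
theorem norm_exp_sub_one_le_of_re_nonpos {z : ℂ} (hz : z.re ≤ 0) : ‖Complex.exp z - 1‖ ≤ ‖z‖ := by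
  have h := (convex_halfSpace_re_le (0 : ℝ)).norm_image_sub_le_of_norm_hasDerivWithin_le
    (f := Complex.exp) (f' := Complex.exp) (C := 1) (x := 0) (y := z)
    (fun w _ => (Complex.hasDerivAt_exp w).hasDerivWithinAt)
    (fun w hw => by rw [Complex.norm_exp]; exact Real.exp_le_one_iff.2 hw) (by simp) hz
  simpa using h

/-- The integral `∫_0^∞ e^{-b z^α + i z} dz` in logarithmic coordinates. -/
def oscIntegral (α b : ℝ) : ℂ :=
  ∫ x : ℝ, Complex.exp (-((b * Real.exp (α * x) : ℝ) : ℂ) + Complex.I * Complex.exp x + x)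

theorem cos_mul_pi_div_four_pos {α : ℝ} (hα : 0 < α) (hα2 : α < 2) :
    0 < Real.cos (α * (Real.pi / 4)) :=
  Real.cos_pos_of_mem_Ioo ⟨by nlinarith [Real.pi_pos], by nlinarith [Real.pi_pos]⟩

/-- On the real axis e^{iz} does not decay, so the shift relies on e^{-b z^α}, whose decay survives
up to angle π/4 because απ/4 < π/2. The weight p = 1 comes from dz = z dx. -/
theorem oscIntegral_eq_rotated {α b : ℝ} (hα : 0 < α) (hα2 : α < 2) (hb : 0 < b) :
    oscIntegral α b = ∫ x : ℝ, Complex.exp (-(b * Complex.exp (α * (x + (Real.pi / 4 : ℝ) *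
      Complex.I)))) * Complex.exp (Complex.I * Complex.exp (x + (Real.pi / 4 : ℝ) * Complex.I) +
        (1 : ℝ) * (x + (Real.pi / 4 : ℝ) * Complex.I)) := by
  have hpi := Real.pi_pos
  have hcos := cos_mul_pi_div_four_pos hα hα2
  have h := integral_horizontal_shift (a := 0) (b := Real.pi / 4) (β := α)
    (G := fun w => Complex.exp (-(b * Complex.exp (α * w))) *
      Complex.exp (Complex.I * Complex.exp w + (1 : ℝ) * w)) (by fun_prop)
    (mul_pos hb hcos) hα one_pos (by positivity) ?_
  · rw [← h, oscIntegral]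
    congr 1
    funext x
    rw [← Complex.exp_add]
    congr 1
    push_cast
    simp only [zero_mul, add_zero]
    ring
  · intro x y hy
    have hsin : 0 ≤ Real.sin y := Real.sin_nonneg_of_nonneg_of_le_pi hy.1 (by linarith [hy.2])
    have hcos' : Real.cos (α * (Real.pi / 4)) ≤ Real.cos (α * y) :=
      Real.cos_le_cos_of_nonneg_of_le_pi (mul_nonneg hα.le hy.1) (by nlinarith)
        (mul_le_mul_of_nonneg_left hy.2 hα.le)
    have e : (α : ℂ) * (x + y * Complex.I) =
        ((α * x : ℝ) : ℂ) + ((α * y : ℝ) : ℂ) * Complex.I := by push_cast; ring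
    rw [norm_mul, norm_exp_I_mul_exp_add, e, exp_add_mul_I, Complex.norm_exp, ← Real.exp_add,
      Real.exp_le_exp]
    have hre : (-((b : ℂ) * (((Real.exp (α * x) * Real.cos (α * y) : ℝ) : ℂ) +
        ((Real.exp (α * x) * Real.sin (α * y) : ℝ) : ℂ) * Complex.I))).re =
        -(b * (Real.exp (α * x) * Real.cos (α * y))) := by
      simp [-Complex.ofReal_mul]
    rw [hre]
    have h1 : 0 ≤ Real.sin y * Real.exp (1 * x) := by positivity
    have h2 : b * Real.cos (α * (Real.pi / 4)) * Real.exp (α * x) ≤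
        b * (Real.exp (α * x) * Real.cos (α * y)) := by
      rw [mul_assoc, mul_comm (Real.cos _)]
      gcongr
    linarith

theorem tendsto_re_oscIntegral_div {α : ℝ} (hα : 0 < α) (hα2 : α < 2) :
    Tendsto (fun b => (oscIntegral α b).re / b) (𝓝[>] 0)
      (𝓝 (Real.Gamma (α + 1) * Real.sin (Real.pi * α / 2))) := by
  have hpi := Real.pi_pos
  set κ := Real.sin (Real.pi / 4) with hκ
  have hκ0 : 0 < κ := Real.sin_pos_of_pos_of_lt_pi (by positivity) (by linarith)
  have hcos := cos_mul_pi_div_four_pos hα hα2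
  let W : ℝ → ℂ := fun x => x + (Real.pi / 4 : ℝ) * Complex.I
  let E : ℝ → ℝ → ℂ := fun p x => Complex.exp (Complex.I * Complex.exp (W x) + p * W x)
  have hEnorm : ∀ p x, ‖E p x‖ = Real.exp (-(κ * Real.exp (1 * x)) + p * x) := fun p x =>
    norm_exp_I_mul_exp_add p x _
  have hWc : Continuous W := by fun_prop
  have hEc : ∀ p, Continuous (E p) := fun p => by fun_prop
  have hEint : ∀ p > 0, Integrable (E p) := fun p hp =>
    (integrable_exp_neg_exp_add hκ0 one_pos hp).mono' (hEc p).aestronglyMeasurable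
      (Eventually.of_forall fun x => (hEnorm p x).le)
  have hEval : ∀ p > 0, ∫ x, E p x = Complex.exp (p * (Real.pi / 2 : ℝ) * Complex.I) *
      Real.Gamma p := fun p hp => integral_exp_I_mul_exp_add hp
  have hmulE : ∀ x, Complex.exp (α * W x) * E 1 x = E (α + 1) x := fun x => by
    simp only [E]
    rw [← Complex.exp_add]
    congr 1
    push_cast
    ring
  have hreW : ∀ x, 0 ≤ (Complex.exp (α * W x)).re := fun x => by
    have e : (α : ℂ) * W x =
        ((α * x : ℝ) : ℂ) + ((α * (Real.pi / 4) : ℝ) : ℂ) * Complex.I := by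
      simp only [W]; push_cast; ring
    rw [e, exp_add_mul_I]
    simp only [Complex.add_re, Complex.ofReal_re, Complex.re_ofReal_mul, Complex.I_re, mul_zero,
      add_zero]
    positivity
  -- Since Re z^α ≥ 0 on the ray, |e^{-b z^α} - 1| ≤ b |z^α|: after division by b the bound is
  -- independent of b.
  have hbound : ∀ b : ℝ, 0 < b → ∀ x, ‖(Complex.exp (-(b * Complex.exp (α * W x))) - 1) * E 1 x‖ ≤
      b * Real.exp (-(κ * Real.exp (1 * x)) + (α + 1) * x) := by
    intro b hb x
    have hre : (-((b : ℂ) * Complex.exp (α * W x))).re ≤ 0 := by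
      rw [Complex.neg_re, Complex.re_ofReal_mul]
      have := mul_nonneg hb.le (hreW x)
      linarith
    calc _ ≤ ‖-((b : ℂ) * Complex.exp (α * W x))‖ * ‖E 1 x‖ := by
          rw [norm_mul]
          gcongr
          exact norm_exp_sub_one_le_of_re_nonpos hre
      _ = b * ‖Complex.exp (α * W x) * E 1 x‖ := by
          rw [norm_neg, norm_mul, norm_mul, Complex.norm_real, Real.norm_of_nonneg hb.le,
            mul_assoc]
      _ = _ := by rw [hmulE, hEnorm]
  have hdom := integrable_exp_neg_exp_add hκ0 one_pos (show 0 < α + 1 by linarith)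
  have hsplit : ∀ b : ℝ, 0 < b → (oscIntegral α b - Complex.I) / b =
      ∫ x, ((Complex.exp (-(b * Complex.exp (α * W x))) - 1) / b) * E 1 x := by
    intro b hb
    have hi : Integrable fun x => (Complex.exp (-(b * Complex.exp (α * W x))) - 1) * E 1 x := by
      refine (hdom.const_mul b).mono' ?_ (Eventually.of_forall fun x => hbound b hb x)
      have := hEc 1
      exact (by fun_prop : Continuous _).aestronglyMeasurable
    have h1 : oscIntegral α b = ∫ x, Complex.exp (-(b * Complex.exp (α * W x))) * E 1 x :=
      oscIntegral_eq_rotated hα hα2 hb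
    -- The zeroth-order term is purely imaginary and disappears on taking real parts, so the real
    -- part is of order b.
    have h2 : ∫ x, E 1 x = Complex.I := by
      rw [hEval 1 one_pos, Real.Gamma_one]
      push_cast
      rw [one_mul, mul_one, Complex.exp_pi_div_two_mul_I]
    have h3 := integral_add hi (hEint 1 one_pos)
    have h4 : ∀ x, (Complex.exp (-(b * Complex.exp (α * W x))) - 1) * E 1 x + E 1 x =
      Complex.exp (-(b * Complex.exp (α * W x))) * E 1 x := fun x => by ring
    simp only [h4] at h3
    rw [h1, h3, h2, add_sub_cancel_right, ← integral_div]
    congr 1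
    funext x
    ring
  have hlim : Tendsto (fun b : ℝ => (oscIntegral α b - Complex.I) / b) (𝓝[>] 0)
      (𝓝 (∫ x, -E (α + 1) x)) := by
    have h := tendsto_integral_filter_of_dominated_convergence (μ := volume) (l := 𝓝[>] (0 : ℝ))
      (F := fun (b : ℝ) x => ((Complex.exp (-(b * Complex.exp (α * W x))) - 1) / b) * E 1 x)
      (f := fun x => -E (α + 1) x) _ ?_ ?_ hdom ?_
    · refine h.congr' ?_
      filter_upwards [self_mem_nhdsWithin] with b hb
      exact (hsplit b hb).symm
    · refine Eventually.of_forall fun b => ?_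
      have := hEc 1
      exact (by fun_prop : Continuous _).aestronglyMeasurable
    · filter_upwards [self_mem_nhdsWithin] with b hb
      have hb : 0 < b := hb
      refine Eventually.of_forall fun x => ?_
      rw [div_mul_eq_mul_div, norm_div, Complex.norm_real, Real.norm_of_nonneg hb.le,
        div_le_iff₀ hb, mul_comm _ b]
      exact hbound b hb x
    · refine Eventually.of_forall fun x => ?_
      rw [← hmulE, ← neg_mul]
      refine Tendsto.mul_const _ ?_
      set q := Complex.exp (α * W x) with hq
      -- The pointwise limit of the difference quotient is the derivative in b at 0, namely -z^α on
      -- the ray.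
      have hd : HasDerivAt (fun b : ℝ => Complex.exp (-(b * q))) (-q) 0 := by
        have h1 : HasDerivAt (fun b : ℝ => -((b : ℂ) * q)) (-(1 * q)) 0 :=
          ((Complex.ofRealCLM.hasDerivAt (x := (0 : ℝ))).mul_const q).neg
        have h2 := h1.cexp
        simpa using h2
      have h3 := (hasDerivAt_iff_tendsto_slope.1 hd).mono_left
        (nhdsWithin_mono (0 : ℝ) (fun b hb => ne_of_gt hb : Set.Ioi (0 : ℝ) ⊆ {0}ᶜ))
      refine h3.congr fun b => ?_
      rw [slope_def_module]
      simp [div_eq_inv_mul]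
  have hre := (Complex.continuous_re.tendsto _).comp hlim
  rw [integral_neg, hEval _ (by linarith)] at hre
  have hval : (-(Complex.exp (((α + 1 : ℝ) : ℂ) * ((Real.pi / 2 : ℝ) : ℂ) * Complex.I) *
      (Real.Gamma (α + 1) : ℂ))).re = Real.Gamma (α + 1) * Real.sin (Real.pi * α / 2) := by
    rw [← Complex.ofReal_mul, Complex.neg_re, Complex.re_mul_ofReal, Complex.exp_ofReal_mul_I_re]
    have : (α + 1) * (Real.pi / 2) = Real.pi * α / 2 + Real.pi / 2 := by ring
    rw [this, Real.cos_add_pi_div_two]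
    ring
  rw [hval] at hre
  refine hre.congr fun b => ?_
  simp [Complex.div_ofReal_re]

theorem stableDensity_neg (ξ α γ : ℝ) :
    stableDensity (-ξ) α 0 γ 0 = stableDensity ξ α 0 γ 0 := by
  unfold stableDensity
  congr 2
  rw [← integral_neg_eq_self]
  congr 1
  funext z
  simp [stableCharFun_symm]

theorem stableDensity_eq_oscIntegral {ξ α γ : ℝ} (hξ : 0 < ξ) (hα : 0 < α) (hγ : 0 < γ) :
    stableDensity ξ α 0 γ 0 =
      1 / Real.pi * (ξ⁻¹ * (oscIntegral α (γ ^ α * ξ ^ (-α))).re) := by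
  have hγα : 0 < γ ^ α := Real.rpow_pos_of_pos hγ α
  have hcont : ∀ b : ℝ, Continuous fun z : ℝ => Complex.exp (-((b * |z| ^ α : ℝ) : ℂ)) *
      Complex.exp (Complex.I * (ξ : ℂ) * (z : ℂ)) := by
    intro b
    have : Continuous fun z : ℝ => |z| ^ α := continuous_abs.rpow_const fun _ => Or.inr hα.le
    fun_prop
  have hnorm : ∀ b z : ℝ, ‖Complex.exp (-((b * |z| ^ α : ℝ) : ℂ)) *
      Complex.exp (Complex.I * (ξ : ℂ) * (z : ℂ))‖ = Real.exp (-(b * |z| ^ α)) := by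
    intro b z
    rw [norm_mul, mul_assoc, mul_comm Complex.I, ← Complex.ofReal_mul,
      Complex.norm_exp_ofReal_mul_I, mul_one, ← Complex.ofReal_neg, Complex.norm_exp_ofReal]
  have hint : ∀ b > 0, Integrable fun z : ℝ => Complex.exp (-((b * |z| ^ α : ℝ) : ℂ)) *
      Complex.exp (Complex.I * (ξ : ℂ) * (z : ℂ)) := fun b hb =>
    (integrable_exp_neg_mul_abs_rpow hα hb).mono' (hcont b).aestronglyMeasurable
      (Eventually.of_forall fun z => (hnorm b z).le)
  have hre : ∀ b z : ℝ, (Complex.exp (-((b * |z| ^ α : ℝ) : ℂ)) *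
      Complex.exp (Complex.I * (ξ : ℂ) * (z : ℂ))).re =
        Real.exp (-(b * |z| ^ α)) * Real.cos (ξ * |z|) := by
    intro b z
    rw [← Complex.ofReal_neg, ← Complex.ofReal_exp, Complex.re_ofReal_mul, mul_assoc,
      mul_comm Complex.I, ← Complex.ofReal_mul, Complex.exp_ofReal_mul_I_re]
    congr 1
    rw [← Real.cos_abs, abs_mul, abs_of_pos hξ]
  have h1 : stableDensity ξ α 0 γ 0 = 1 / (2 * Real.pi) *
      ∫ z : ℝ, Real.exp (-(γ ^ α * |z| ^ α)) * Real.cos (ξ * |z|) := by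
    have e : (1 / (2 * Real.pi) : ℂ) = ((1 / (2 * Real.pi) : ℝ) : ℂ) := by push_cast; rfl
    rw [stableDensity, e, Complex.re_ofReal_mul]
    congr 1
    simp only [← hre]
    rw [← Complex.reCLM_apply, ← ContinuousLinearMap.integral_comp_comm]
    · simp only [stableCharFun_symm, Complex.reCLM_apply, abs_mul, abs_of_pos hγ,
        Real.mul_rpow hγ.le (abs_nonneg _), Complex.ofReal_exp, Complex.ofReal_neg]
    · have := hint _ hγα
      simpa only [stableCharFun_symm, abs_mul, abs_of_pos hγ,
        Real.mul_rpow hγ.le (abs_nonneg _), Complex.ofReal_exp, Complex.ofReal_neg] using this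
  have h2 : ∫ z in Set.Ioi (0 : ℝ), Real.exp (-(γ ^ α * z ^ α)) * Real.cos (ξ * z) =
      (∫ z in Set.Ioi (0 : ℝ), Complex.exp (-((γ ^ α * |z| ^ α : ℝ) : ℂ)) *
        Complex.exp (Complex.I * (ξ : ℂ) * (z : ℂ))).re := by
    rw [← Complex.reCLM_apply, ← ContinuousLinearMap.integral_comp_comm _
      (hint _ hγα).integrableOn]
    refine setIntegral_congr_fun measurableSet_Ioi fun z hz => ?_
    rw [Complex.reCLM_apply, hre, abs_of_pos (Set.mem_Ioi.1 hz)]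
  have h3 : ∫ z in Set.Ioi (0 : ℝ), Complex.exp (-((γ ^ α * |z| ^ α : ℝ) : ℂ)) *
        Complex.exp (Complex.I * (ξ : ℂ) * (z : ℂ)) =
      ((ξ⁻¹ : ℝ) : ℂ) * oscIntegral α (γ ^ α * ξ ^ (-α)) := by
    -- Translating by log ξ in the logarithmic coordinate is the scaling z ↦ z/ξ.
    rw [integral_comp_exp_mul, ← integral_sub_right_eq_self _ (Real.log ξ), oscIntegral,
      ← integral_const_mul]
    congr 1
    funext x
    rw [Real.exp_sub, Real.exp_log hξ, abs_of_pos (by positivity),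
      Real.div_rpow (Real.exp_pos x).le hξ.le, ← Real.exp_mul, Complex.real_smul, Real.rpow_neg hξ.le,
      Complex.exp_add, Complex.exp_add, mul_comm x α]
    have hξ' : (ξ : ℂ) ≠ 0 := by exact_mod_cast hξ.ne'
    have e1 : γ ^ α * (Real.exp (α * x) / ξ ^ α) = γ ^ α * (ξ ^ α)⁻¹ * Real.exp (α * x) := by
      rw [div_eq_mul_inv]; ring
    have e2 : Complex.I * (ξ : ℂ) * ((Real.exp x / ξ : ℝ) : ℂ) = Complex.I * Complex.exp x := by
      push_cast
      field_simp
    rw [e1, e2]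
    push_cast
    field_simp
  rw [h1, integral_comp_abs (f := fun z => Real.exp (-(γ ^ α * z ^ α)) * Real.cos (ξ * z)), h2, h3,
    Complex.re_ofReal_mul]
  have := Real.pi_ne_zero
  field_simp

theorem tendsto_stableDensity_mul_rpow {α γ : ℝ} (hα : 0 < α) (hα2 : α < 2) (hγ : 0 < γ) :
    Tendsto (fun ξ : ℝ => stableDensity ξ α 0 γ 0 / (1 / |ξ| ^ (α + 1))) atTop
      (𝓝 (γ ^ α / Real.pi * (Real.Gamma (α + 1) * Real.sin (Real.pi * α / 2)))) := by
  have hγα : 0 < γ ^ α := Real.rpow_pos_of_pos hγ α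
  have hb : Tendsto (fun ξ : ℝ => γ ^ α * ξ ^ (-α)) atTop (𝓝[>] 0) := by
    refine tendsto_nhdsWithin_iff.2 ⟨?_, ?_⟩
    · simpa using (tendsto_rpow_neg_atTop hα).const_mul (γ ^ α)
    · filter_upwards [eventually_gt_atTop 0] with ξ hξ
      exact mul_pos hγα (Real.rpow_pos_of_pos hξ _)
  refine (((tendsto_re_oscIntegral_div hα hα2).comp hb).const_mul (γ ^ α / Real.pi)).congr' ?_
  filter_upwards [eventually_gt_atTop 0] with ξ hξ
  rw [stableDensity_eq_oscIntegral hξ hα hγ, abs_of_pos hξ, Real.rpow_add_one hξ.ne']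
  simp only [Function.comp]
  have h1 : ξ ^ α ≠ 0 := (Real.rpow_pos_of_pos hξ α).ne'
  have h2 : ξ ^ (-α) = (ξ ^ α)⁻¹ := Real.rpow_neg hξ.le α
  have := Real.pi_ne_zero
  have := hγα.ne'
  generalize (oscIntegral α (γ ^ α * ξ ^ (-α))).re = J
  rw [h2]
  field_simp

end PathLaplacian

end

/-! ### Assembly of the two regimes. -/

theorem mainTheorem7 (s : ℝ) (hs : 1 < s) (u : ℝ → PathLaplacian.EllTwo)
    (hu : PathLaplacian.IsSolution (PathLaplacian.mellinLaplacian s) PathLaplacian.e0 u) :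
    (s < 3 → ∀ α γ : ℝ, α = s - 1 →
      γ = (-(Real.pi / (Real.Gamma s * Real.cos (Real.pi * s / 2)))) ^ (1 / (s - 1)) →
      PathLaplacian.HasStableAsymptotics u α γ ∧
      Tendsto (fun ξ : ℝ => PathLaplacian.stableDensity ξ α 0 γ 0 / (1 / |ξ| ^ s))
        atTop (𝓝 1) ∧
      Tendsto (fun ξ : ℝ => PathLaplacian.stableDensity ξ α 0 γ 0 / (1 / |ξ| ^ s))
        atBot (𝓝 1)) ∧
    (3 < s → ∀ α γ : ℝ, α = 2 → γ = Real.sqrt (riemannZeta ((s : ℂ) - 2)).re →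
      PathLaplacian.HasStableAsymptotics u α γ) := by
  refine ⟨fun hs3 α γ hα hγ => ?_, fun hs3 α γ hα hγ => ?_⟩
  · subst hα
    have hpi := Real.pi_pos
    have hΓ : 0 < Real.Gamma s := Real.Gamma_pos_of_pos (by linarith)
    have hsin : 0 < Real.sin (Real.pi * (s - 1) / 2) :=
      Real.sin_pos_of_pos_of_lt_pi (by nlinarith) (by nlinarith)
    have hcos : Real.cos (Real.pi * s / 2) = -Real.sin (Real.pi * (s - 1) / 2) := by
      have : Real.pi * (s - 1) / 2 = Real.pi * s / 2 - Real.pi / 2 := by ring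
      rw [this, Real.sin_sub_pi_div_two, neg_neg]
    have hC : -(Real.pi / (Real.Gamma s * Real.cos (Real.pi * s / 2))) =
        Real.pi / (Real.Gamma s * Real.sin (Real.pi * (s - 1) / 2)) := by
      rw [hcos, mul_neg, div_neg, neg_neg]
    -- Positivity of the base, from 0 < π(s-1)/2 < π, is what lets the power s - 1 undo the root
    -- defining γ.
    have hC0 : 0 < -(Real.pi / (Real.Gamma s * Real.cos (Real.pi * s / 2))) := by
      rw [hC]; positivity
    have hγ0 : 0 < γ := hγ ▸ Real.rpow_pos_of_pos hC0 _
    have hs1 : s - 1 ≠ 0 := by linarith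
    have hγα : γ ^ (s - 1) = -(Real.pi / (Real.Gamma s * Real.cos (Real.pi * s / 2))) := by
      rw [hγ, ← Real.rpow_mul hC0.le, one_div_mul_cancel hs1, Real.rpow_one]
    have htop : Tendsto (fun ξ : ℝ =>
        PathLaplacian.stableDensity ξ (s - 1) 0 γ 0 / (1 / |ξ| ^ s)) atTop (𝓝 1) := by
      have h := PathLaplacian.tendsto_stableDensity_mul_rpow (α := s - 1) (by linarith)
        (by linarith) hγ0
      -- With this value of γ^{s-1} the factors π, Γ(s) and the sine all cancel, leaving the limit
      -- 1.
      rw [sub_add_cancel, hγα, hC] at h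
      convert! h using 2
      field_simp
    refine ⟨?_, htop, ?_⟩
    · refine PathLaplacian.hasStableAsymptotics_of_symbol hs hu (by linarith) (by linarith) hγ0 ?_
      rw [hγα, ← PathLaplacian.integral_one_sub_cos_mul_rpow hs hs3]
      exact PathLaplacian.tendsto_symbol_div_rpow hs hs3
    · refine (htop.comp tendsto_neg_atBot_atTop).congr fun ξ => ?_
      simp only [Function.comp, PathLaplacian.stableDensity_neg, abs_neg]
  · subst hα
    have hz : (riemannZeta ((s : ℂ) - 2)).re = ∑' k : ℕ, 1 / ((k : ℝ) + 1) ^ (s - 2) := by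
      rw [← PathLaplacian.re_riemannZeta_eq_tsum (by linarith)]
      push_cast
      rfl
    have hpos : 0 < ∑' k : ℕ, 1 / ((k : ℝ) + 1) ^ (s - 2) :=
      (PathLaplacian.summable_one_div_succ_rpow (s := s - 2) (by linarith)).tsum_pos
        (fun k => by positivity) 0 (by simp)
    refine PathLaplacian.hasStableAsymptotics_of_symbol hs hu two_pos le_rfl
      (hγ ▸ Real.sqrt_pos.2 (hz ▸ hpos)) ?_
    rw [hγ, Real.rpow_two, Real.sq_sqrt (hz ▸ hpos.le), hz]
    exact PathLaplacian.tendsto_symbol_div_sq hs3
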